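/- Let $\mathcal T$ be the binary rooted tree, whose vertices are the finite words over $\{0,1\}$. For a sequence $\omega=(\omega_1,\omega_2,\dots)$ in $\{0,1,2\}$ put $\sigma\omega=(\omega_2,\omega_3,\dots)$. Let $a$ be the automorphism of $\mathcal T$ that changes the first letter of every non-empty word, and for $k\in\{0,1,2\}$ let $x_k=x_{k,\omega}$ be the automorphism of $\mathcal T$ that fixes the first level, acts on the subtree at the vertex $1$ as $x_{k,\sigma\omega}$, and acts on the subtree at the vertex $0$ trivially if $\omega_1=k$ and as $a$ otherwise; write $b_\omega=x_2$, $c_\omega=x_1$, $d_\omega=x_0$. The Grigorchuk group of $\omega$ is $G_\omega=\langle a,b_\omega,c_\omega,d_\omega\rangle\le\mathrm{Aut}(\mathcal T)$, and $\mathrm{St}(n)$ denotes the subgroup of all elements of $G_\omega$ that fix every vertex of level $n$. A spherical system of generators of size $r\ge 3$ of a group $G$ is a tuple $T=(g_1,\dots,g_r)$ of non-trivial elements with $\langle g_1,\dots,g_r\rangle=G$ and $g_1\cdots g_r=e$; put $\Sigma(T)=\bigcup_{g\in G}\bigcup_{i=1}^r\langle g_i\rangle^g$. A ramification structure of size $(r_1,r_2)$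 for a finite group $G$ is a pair $(T_1,T_2)$ of spherical systems of generators of sizes $r_1$ and $r_2$ with $\Sigma(T_1)\cap\Sigma(T_2)=\{e\}$. For $k\in\{0,1,2\}$ let $i_k(\sigma\omega)=\min\{m\ge 1\mid \omega_{m+1}=k\}$, or $\infty$ if $k$ does not occur in $\sigma\omega$. Put $N=\max\{i_0(\sigma\omega),i_1(\sigma\omega),i_2(\sigma\omega)\}+4$ and, if exactly one $i_k(\sigma\omega)$ is infinite, $\widetilde N=\max\{i_j(\sigma\omega)\mid j\neq k\}+4$. Let $M=N$ if $N$ is finite, $M=\widetilde N$ if $N$ is infinite and $\sigma\omega$ is not constant, and $M=4$ if $\sigma\omega$ is constant. **Theorem.** Let $\omega$ be a non-constant sequence in $\{0,1,2\}$ and let $n\ge M$. Then $G_\omega/\mathrm{St}(n)$ is a finite $2$-group and admits a ramification structure of size $(4,4)$. Explicitly, let $\{i,j,k\}=\{0,1,2\}$ and write $d,c,b$ for the images of $x_i,x_j,x_k$ (and $a$ for that of $a$) in $G_\omega/\mathrm{St}(n)$. (1) If $\sigma\omega$ is not constant and $\omega_1\ne i$, then $$T_1=\bigl(a,\,b,\,cab,\,(adab)^{-1}\bigr),\qquad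 T_2=\bigl(ac,\,c,\,dac,\,(adac)^{-1}\bigr)$$ form a ramification structure for $G_\omega/\mathrm{St}(n)$. (2) If $\omega_1=k$ and $\omega_m=i$ for all $m\ge 2$, then $$T_1=\bigl(a,\,b,\,c,\,(ad)^{-1}\bigr),\qquad T_2=\bigl(ab,\,d,\,abad,\,(acabad)^{-1}\bigr)$$ form a ramification structure for $G_\omega/\mathrm{St}(n)$. -/

import Mathlib

namespace Grigorchuk

/-! ### Ramification structures -/

section Ramification

variable {G : Type*} [Group G]

/-- A spherical system of generators: a tuple of at least three non-trivial elements that generate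
the group and whose product, in order, is the identity. -/
structure IsSphericalSystem {r : ℕ} (T : Fin r → G) : Prop where
  three_le : 3 ≤ r
  ne_one : ∀ i, T i ≠ 1
  generates : Subgroup.closure (Set.range T) = ⊤
  prod_eq_one : (List.ofFn T).prod = 1

/-- The union of all conjugates of the cyclic subgroups generated by the entries of a tuple. -/
def conjCyclic {r : ℕ} (T : Fin r → G) : Set G :=
  {x | ∃ (g : G) (i : Fin r), ∃ y ∈ Subgroup.zpowers (T i), x = g⁻¹ * y * g}

/-- `(T₁, T₂)` is an (unmixed) ramification structure: both tuples are spherical systems of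
generators, and they are disjoint. -/
structure IsRamificationStructure {r₁ r₂ : ℕ} (T₁ : Fin r₁ → G) (T₂ : Fin r₂ → G) : Prop where
  left : IsSphericalSystem T₁
  right : IsSphericalSystem T₂
  disjoint : conjCyclic T₁ ∩ conjCyclic T₂ = {1}

variable (G) in
/-- The group `G` is finite and admits a ramification structure of size `(r₁, r₂)`. -/
def AdmitsRamificationStructure (r₁ r₂ : ℕ) : Prop :=
  Finite G ∧ ∃ (T₁ : Fin r₁ → G) (T₂ : Fin r₂ → G), IsRamificationStructure T₁ T₂

/-- The tuple `(a, b, cab, (adab)⁻¹)`. -/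
def tupleT₁ (a b c d : G) : Fin 4 → G := ![a, b, c * a * b, (a * d * a * b)⁻¹]

/-- The tuple `(ac, c, dac, (adac)⁻¹)`. -/
def tupleT₂ (a c d : G) : Fin 4 → G := ![a * c, c, d * a * c, (a * d * a * c)⁻¹]

/-- The tuple `(a, b, c, (ad)⁻¹)`. -/
def tupleS₁ (a b c d : G) : Fin 4 → G := ![a, b, c, (a * d)⁻¹]

/-- The tuple `(ab, d, abad, (acabad)⁻¹)`. -/
def tupleS₂ (a b c d : G) : Fin 4 → G :=
  ![a * b, d, a * b * a * d, (a * c * a * b * a * d)⁻¹]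

end Ramification

/-! ### Automorphisms of the binary rooted tree

Vertices are finite words over `{0, 1}`, written as lists with `false = 0` and `true = 1`;
the root is the empty word, and a vertex precedes another if it is a prefix of it. -/

theorem perm_apply_inv {α : Type*} (f : Equiv.Perm α) (x : α) : f (f⁻¹ x) = x :=
  f.apply_symm_apply x

/-- The automorphism group of the binary rooted tree, as a group of permutations of the
vertices: those that preserve the levels and the prefix relation. -/
def treeAut : Subgroup (Equiv.Perm (List Bool)) where
  carrier := {f | (∀ v, (f v).length = v.length) ∧ ∀ u v, f u <+: f v ↔ u <+: v}
  one_mem' := ⟨fun _ => rfl, fun _ _ => Iff.rfl⟩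
  mul_mem' := by
    rintro f g ⟨hf, hf'⟩ ⟨hg, hg'⟩
    refine ⟨fun v => ?_, fun u v => ?_⟩
    · rw [Equiv.Perm.mul_apply, hf, hg]
    · rw [Equiv.Perm.mul_apply, Equiv.Perm.mul_apply, hf', hg']
  inv_mem' := by
    rintro f ⟨hf, hf'⟩
    refine ⟨fun v => ?_, fun u v => ?_⟩
    · rw [← hf, perm_apply_inv]
    · rw [← hf', perm_apply_inv, perm_apply_inv]

/-- The stabiliser of the `n`-th level: all automorphisms that fix every vertex of level `n`. -/
def levelStab (n : ℕ) : Subgroup treeAut where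
  carrier := {g | ∀ v : List Bool, v.length = n → g.1 v = v}
  one_mem' := fun _ _ => rfl
  mul_mem' := by
    intro f g hf hg v hv
    change f.1 (g.1 v) = v
    rw [hg v hv, hf v hv]
  inv_mem' := by
    intro f hf v hv
    change (f.1)⁻¹ v = v
    rw [Equiv.Perm.inv_eq_iff_eq, hf v hv]

instance levelStab_normal (n : ℕ) : (levelStab n).Normal where
  conj_mem := by
    intro f hf g v hv
    change g.1 (f.1 ((g.1)⁻¹ v)) = v
    have h : ((g.1)⁻¹ v).length = n := by
      rw [← g.2.1, perm_apply_inv, hv]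
    rw [hf _ h, perm_apply_inv]

/-- An involution of the vertices that preserves levels and prefixes, as a tree automorphism. -/
def autOfInvolutive (f : List Bool → List Bool) (h : Function.Involutive f)
    (hl : ∀ v, (f v).length = v.length) (hp : ∀ u v, u <+: v → f u <+: f v) : treeAut :=
  ⟨h.toPerm f, hl, fun u v => ⟨fun huv => by
    have := hp _ _ huv
    rwa [Function.Involutive.coe_toPerm, h u, h v] at this, hp u v⟩⟩

/-- Change the first letter of a word. -/
def swapFun : List Bool → List Bool
  | [] => []
  | x :: v => (!x) :: v

theorem swapFun_involutive : Function.Involutive swapFun := by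
  rintro (_ | ⟨x, v⟩) <;> simp [swapFun]

theorem swapFun_length (v : List Bool) : (swapFun v).length = v.length := by
  cases v <;> simp [swapFun]

theorem swapFun_prefix (u v : List Bool) (h : u <+: v) : swapFun u <+: swapFun v := by
  obtain ⟨w, rfl⟩ := h
  cases u <;> simp [swapFun]

/-- The rooted automorphism `a`, which swaps the two maximal subtrees. -/
def rootedA : treeAut := autOfInvolutive swapFun swapFun_involutive swapFun_length swapFun_prefix

/-- The shift `σ`. A sequence `ω = (ω₁, ω₂, …)` in `{0, 1, 2}` is a function on `ℕ` whose value
at `m` is the entry `ω_{m+1}`; in particular `ω 0` is the first entry. -/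
def shift (ω : ℕ → Fin 3) : ℕ → Fin 3 := fun m => ω (m + 1)

/-- The action of the directed automorphism attached to the letter `k` and the sequence `ω`:
it fixes the first level, its section at `1` is the one attached to `k` and `σω`, and its section
at `0` is trivial if the first entry of `ω` is `k`, and the rooted swap otherwise. -/
def directedFun (k : Fin 3) : (ℕ → Fin 3) → List Bool → List Bool
  | _, [] => []
  | ω, true :: v => true :: directedFun k (shift ω) v
  | ω, false :: v => false :: (if ω 0 = k then v else swapFun v)

theorem directedFun_involutive (k : Fin 3) (ω : ℕ → Fin 3) :
    Function.Involutive (directedFun k ω) := by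
  intro v
  induction v generalizing ω with
  | nil => rfl
  | cons x v ih =>
    cases x
    · by_cases h : ω 0 = k <;> simp [directedFun, h, swapFun_involutive v]
    · simp [directedFun, ih]

theorem directedFun_length (k : Fin 3) (ω : ℕ → Fin 3) (v : List Bool) :
    (directedFun k ω v).length = v.length := by
  induction v generalizing ω with
  | nil => rfl
  | cons x v ih =>
    cases x
    · by_cases h : ω 0 = k <;> simp [directedFun, h, swapFun_length v]
    · simp [directedFun, ih]

theorem directedFun_prefix (k : Fin 3) (ω : ℕ → Fin 3) (u v : List Bool) (h : u <+: v) :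
    directedFun k ω u <+: directedFun k ω v := by
  obtain ⟨w, rfl⟩ := h
  induction u generalizing ω with
  | nil => simp [directedFun]
  | cons x u ih =>
    cases x
    · by_cases h : ω 0 = k
      · simp [directedFun, h]
      · simpa [directedFun, h] using swapFun_prefix u (u ++ w) (List.prefix_append u w)
    · simpa [directedFun] using ih (shift ω)

/-- The directed automorphism attached to the letter `k`. -/
def directed (k : Fin 3) (ω : ℕ → Fin 3) : treeAut :=
  autOfInvolutive (directedFun k ω) (directedFun_involutive k ω) (directedFun_length k ω)
    (directedFun_prefix k ω)

/-- The directed generator `b_ω`. -/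
abbrev directedB (ω : ℕ → Fin 3) : treeAut := directed 2 ω

/-- The directed generator `c_ω`. -/
abbrev directedC (ω : ℕ → Fin 3) : treeAut := directed 1 ω

/-- The directed generator `d_ω`. -/
abbrev directedD (ω : ℕ → Fin 3) : treeAut := directed 0 ω

/-- The Grigorchuk group `G_ω`. -/
def grigorchukGroup (ω : ℕ → Fin 3) : Subgroup treeAut :=
  Subgroup.closure {rootedA, directedB ω, directedC ω, directedD ω}

/-- The quotient `G_ω / St_{G_ω}(n)`. -/
abbrev levelQuotient (ω : ℕ → Fin 3) (n : ℕ) : Type :=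
  grigorchukGroup ω ⧸ (levelStab n).subgroupOf (grigorchukGroup ω)

theorem rootedA_mem (ω : ℕ → Fin 3) : rootedA ∈ grigorchukGroup ω :=
  Subgroup.subset_closure (by simp)

theorem directed_mem (k : Fin 3) (ω : ℕ → Fin 3) : directed k ω ∈ grigorchukGroup ω := by
  apply Subgroup.subset_closure
  fin_cases k <;> simp

/-- The image of `a` in `G_ω / St_{G_ω}(n)`. -/
def quotA (ω : ℕ → Fin 3) (n : ℕ) : levelQuotient ω n :=
  QuotientGroup.mk (⟨rootedA, rootedA_mem ω⟩ : grigorchukGroup ω)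

/-- The image in `G_ω / St_{G_ω}(n)` of the directed generator attached to the letter `k`; the
letters `2`, `1`, `0` give the images of `b_ω`, `c_ω`, `d_ω`. -/
def quotDirected (k : Fin 3) (ω : ℕ → Fin 3) (n : ℕ) : levelQuotient ω n :=
  QuotientGroup.mk (⟨directed k ω, directed_mem k ω⟩ : grigorchukGroup ω)

/-! ### The bound `M` -/

/-- `ω` is a constant sequence. -/
def IsConstant (ω : ℕ → Fin 3) : Prop := ∃ k, ∀ m, ω m = k

/-- `i_k(ω)`: the least position, counted from `1`, at which the letter `k` occurs in `ω`, and
`∞` if there is none. -/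
noncomputable def firstIndex (k : Fin 3) (ω : ℕ → Fin 3) : ℕ∞ :=
  ⨅ (m : ℕ) (_ : ω m = k), ((m + 1 : ℕ) : ℕ∞)

/-- `N = max{i_0(σω), i_1(σω), i_2(σω)} + 4`. -/
noncomputable def boundN (ω : ℕ → Fin 3) : ℕ∞ :=
  (⨆ k, firstIndex k (shift ω)) + 4

/-- The maximum of the finite ones among the `i_k(σω)`, plus `4`. -/
noncomputable def boundNTilde (ω : ℕ → Fin 3) : ℕ∞ :=
  (⨆ (k) (_ : firstIndex k (shift ω) ≠ ⊤), firstIndex k (shift ω)) + 4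

open Classical in
/-- The bound `M`. -/
noncomputable def boundM (ω : ℕ → Fin 3) : ℕ∞ :=
  if boundN ω ≠ ⊤ then boundN ω
  else if ¬ IsConstant (shift ω) then boundNTilde ω
  else 4

end Grigorchuk

/-!
The quotient `G_ω / St(n)` embeds into the automorphism group of the finite binary tree of depth
`n`, a finite `2`-group. In a finite `2`-group two tuples are disjoint as soon as the unique
involutions of the cyclic groups generated by their entries are pairwise non-conjugate
(`conjCyclic_inter`), and it turns out that these involutions are not even conjugate under the full
automorphism group of the tree, which is generated by the pairs `(f, g)` of automorphisms of the
two subtrees together with `a` (`exists_eq_pair`).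

Two automorphisms `(f, g)` and `(f', g')` fixing the first level are conjugate only if `f, g` are
conjugate to `f', g'` in some order (`ConjMod.pair_cases`). So an involution has a type: either it
moves the first level, or it has an unordered pair of conjugacy classes of sections. Write `x_l'` for
the directed automorphisms of `σω`. For all the entries of the tuples the sections that occur are
`1`, automorphisms moving the first level, directed automorphisms `x_l'`, and the involutions in the
groups generated by `a x_l'`. These belong to different classes (`HasKind.unique`):

* The square of `a x_l` is `(x_l', x_l')` if `ω₁ = l`, and otherwise it is `(x_l' a, a x_l')`. So the
  involution attached to `a x_l` has conjugate sections, while the sections of a directed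
  automorphism are `1` or `a` and another directed automorphism
  (`InvPow.not_conjMod_directed`).
* For `l ≠ m` the involutions attached to `a x_l` and `a x_m` are compared by descending along `ω` to
  the first occurrence of `l` or `m`, where one of them becomes a pair of directed automorphisms
  and the other one does not (`InvPow.not_conjMod`). The bound `M` ensures that this happens above
  the level `n` (`exists_eq_or_eq`).

It remains to compute the types of the involutions attached to the entries of the tuples, and to
observe that the two sets of types are disjoint. If `σω` is constant with value `i`, then `x_i = (a, 1)`
and the types are computed separately.
-/

namespace Grigorchuk

/-! ### Tree automorphisms and their sections -/

@[ext]
theorem treeAut_ext {f g : treeAut} (h : ∀ v, f.1 v = g.1 v) : f = g :=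
  Subtype.ext (Equiv.ext h)

theorem length_apply (f : treeAut) (v : List Bool) : (f.1 v).length = v.length := f.2.1 v

theorem apply_nil (f : treeAut) : f.1 [] = [] :=
  List.length_eq_zero_iff.1 (length_apply f [])

/-- The underlying map of `pair f g`. -/
def pairFun (f g : List Bool → List Bool) : List Bool → List Bool
  | [] => []
  | false :: v => false :: f v
  | true :: v => true :: g v

/-- The automorphism `(f, g)` fixing the first level, with section `f` at the vertex `0` and
section `g` at the vertex `1`. -/
def pair (f g : treeAut) : treeAut :=
  ⟨{ toFun := pairFun f.1 g.1
     invFun := pairFun (f⁻¹).1 (g⁻¹).1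
     left_inv := by
      rintro (_ | ⟨_ | _, v⟩)
      · rfl
      · exact congrArg _ (f.1.symm_apply_apply v)
      · exact congrArg _ (g.1.symm_apply_apply v)
     right_inv := by
      rintro (_ | ⟨_ | _, v⟩)
      · rfl
      · exact congrArg _ (f.1.apply_symm_apply v)
      · exact congrArg _ (g.1.apply_symm_apply v) }, by
    constructor
    · rintro (_ | ⟨_ | _, v⟩)
      · rfl
      · simpa [pairFun] using f.2.1 v
      · simpa [pairFun] using g.2.1 v
    · rintro (_ | ⟨_ | _, u⟩) (_ | ⟨_ | _, v⟩) <;>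
        simp [pairFun, f.2.2, g.2.2]⟩

theorem pair_apply_false (f g : treeAut) (v : List Bool) :
    (pair f g).1 (false :: v) = false :: f.1 v := rfl

theorem pair_apply_true (f g : treeAut) (v : List Bool) :
    (pair f g).1 (true :: v) = true :: g.1 v := rfl

theorem mul_apply (f g : treeAut) (v : List Bool) : (f * g).1 v = f.1 (g.1 v) := rfl

theorem rootedA_apply_cons (x : Bool) (v : List Bool) :
    rootedA.1 (x :: v) = (!x) :: v := rfl

theorem pair_mul (f g f' g' : treeAut) : pair f g * pair f' g' = pair (f * f') (g * g') := by
  ext1 v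
  rcases v with _ | ⟨_ | _, v⟩ <;> rfl

theorem pair_one_one : pair 1 1 = 1 := by
  ext1 v
  rcases v with _ | ⟨_ | _, v⟩ <;> rfl

theorem pair_pow (f g : treeAut) (m : ℕ) : pair f g ^ m = pair (f ^ m) (g ^ m) := by
  induction m with
  | zero => simp [pair_one_one]
  | succ m ih => rw [pow_succ, ih, pair_mul, pow_succ, pow_succ]

theorem rootedA_mul_self : rootedA * rootedA = 1 := by
  ext1 v
  exact swapFun_involutive v

theorem rootedA_mul_pair (f g : treeAut) : rootedA * pair f g = pair g f * rootedA := by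
  ext1 v
  rcases v with _ | ⟨_ | _, v⟩ <;> rfl

theorem directed_eq (k : Fin 3) (ω : ℕ → Fin 3) :
    directed k ω = pair (if ω 0 = k then 1 else rootedA) (directed k (shift ω)) := by
  ext1 v
  rcases v with _ | ⟨_ | _, v⟩
  · rfl
  · change false :: (if ω 0 = k then v else swapFun v) = _
    rw [pair_apply_false]
    split_ifs <;> rfl
  · rfl

theorem directed_mul_self (k : Fin 3) (ω : ℕ → Fin 3) : directed k ω * directed k ω = 1 := by
  ext1 v
  exact directedFun_involutive k ω v

/-- The product of the three directed automorphisms is trivial, since at each vertex of the spine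
exactly two of them act as the rooted swap. -/
theorem directed_mul_directed {i j k : Fin 3} (hij : i ≠ j) (hik : i ≠ k) (hjk : j ≠ k)
    (ω : ℕ → Fin 3) : directed i ω * directed j ω = directed k ω := by
  ext1 v
  induction v generalizing ω with
  | nil => rfl
  | cons x v ih =>
    rw [directed_eq i, directed_eq j, directed_eq k, pair_mul]
    cases x
    · rw [pair_apply_false, pair_apply_false]
      have h : ω 0 = i ∨ ω 0 = j ∨ ω 0 = k := by
        generalize ω 0 = w
        clear ih
        revert i j k w
        decide
      rcases h with h | h | h
      · simp [h, hij, hik]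
      · simp [h, hij.symm, hjk]
      · simp [h, hik.symm, hjk.symm, rootedA_mul_self]
    · rw [pair_apply_true, pair_apply_true, ih]

theorem apply_cons_of_apply_singleton {h : treeAut} {x : Bool} (hx : h.1 [x] = [x])
    (v : List Bool) : h.1 (x :: v) = x :: (h.1 (x :: v)).tail := by
  have := (h.2.2 [x] (x :: v)).2 (by simp)
  rw [hx] at this
  obtain ⟨w, hw⟩ := this
  rw [← hw]
  rfl

/-- The section of an automorphism at a fixed vertex `x` of the first level. -/
def sectionAt (h : treeAut) (x : Bool) (hx : h.1 [x] = [x]) : treeAut :=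
  have hx' : (h⁻¹).1 [x] = [x] := by
    change (h.1)⁻¹ [x] = [x]
    rw [Equiv.Perm.inv_eq_iff_eq, hx]
  ⟨{ toFun := fun v => (h.1 (x :: v)).tail
     invFun := fun v => ((h⁻¹).1 (x :: v)).tail
     left_inv := fun v => by
      beta_reduce
      rw [← apply_cons_of_apply_singleton hx, ← mul_apply, inv_mul_cancel]
      rfl
     right_inv := fun v => by
      beta_reduce
      rw [← apply_cons_of_apply_singleton hx', ← mul_apply, mul_inv_cancel]
      rfl }, by
    refine ⟨fun v => ?_, fun u v => ?_⟩
    · change (h.1 (x :: v)).tail.length = _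
      rw [List.length_tail, length_apply]
      rfl
    · change (h.1 (x :: u)).tail <+: (h.1 (x :: v)).tail ↔ _
      have := h.2.2 (x :: u) (x :: v)
      rw [apply_cons_of_apply_singleton hx u, apply_cons_of_apply_singleton hx v] at this
      simpa using this⟩

theorem exists_eq_pair_of_fix {h : treeAut} (h0 : h.1 [false] = [false])
    (h1 : h.1 [true] = [true]) : ∃ f g, h = pair f g := by
  refine ⟨sectionAt h false h0, sectionAt h true h1, treeAut_ext ?_⟩
  rintro (_ | ⟨_ | _, v⟩)
  · exact apply_nil h
  · exact apply_cons_of_apply_singleton h0 v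
  · exact apply_cons_of_apply_singleton h1 v

/-- An automorphism acts on the first level trivially or as the rooted swap. -/
theorem exists_eq_pair (h : treeAut) : ∃ f g, h = pair f g ∨ h = pair f g * rootedA := by
  have key : ∀ x, ∃ y, h.1 [x] = [y] := fun x =>
    List.length_eq_one_iff.1 (length_apply h [x])
  obtain ⟨y, hy⟩ := key false
  obtain ⟨z, hz⟩ := key true
  have hyz : y ≠ z := by
    rintro rfl
    simpa using h.1.injective (hy.trans hz.symm)
  cases y <;> cases z
  · exact absurd rfl hyz
  · obtain ⟨f, g, hfg⟩ := exists_eq_pair_of_fix hy hz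
    exact ⟨f, g, Or.inl hfg⟩
  · obtain ⟨f, g, hfg⟩ := exists_eq_pair_of_fix (h := h * rootedA) hz hy
    refine ⟨f, g, Or.inr ?_⟩
    rw [← hfg, mul_assoc, rootedA_mul_self, mul_one]
  · exact absurd rfl hyz

/-! ### Level stabilisers -/

theorem levelStab_zero : levelStab 0 = ⊤ := by
  refine eq_top_iff.2 fun g _ v hv => ?_
  rw [List.length_eq_zero_iff.1 hv, apply_nil]

theorem pair_mem_levelStab {n : ℕ} {f g : treeAut} :
    pair f g ∈ levelStab (n + 1) ↔ f ∈ levelStab n ∧ g ∈ levelStab n := by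
  refine ⟨fun h => ⟨fun v hv => ?_, fun v hv => ?_⟩, ?_⟩
  · simpa [pair_apply_false] using h (false :: v) (by simp [hv])
  · simpa [pair_apply_true] using h (true :: v) (by simp [hv])
  · rintro ⟨hf, hg⟩ (_ | ⟨_ | _, v⟩) hv
    · rfl
    · rw [pair_apply_false, hf v (by simpa using hv)]
    · rw [pair_apply_true, hg v (by simpa using hv)]

theorem pair_mem_levelStab_one (f g : treeAut) : pair f g ∈ levelStab 1 :=
  pair_mem_levelStab.2 (by simp [levelStab_zero])

theorem directed_mem_levelStab_one (k : Fin 3) (ω : ℕ → Fin 3) :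
    directed k ω ∈ levelStab 1 := by
  rw [directed_eq]
  exact pair_mem_levelStab_one _ _

theorem rootedA_notMem_levelStab_one : rootedA ∉ levelStab 1 := fun h => by
  simpa [rootedA_apply_cons] using h [true] rfl

theorem levelStab_anti {m n : ℕ} (hmn : m ≤ n) : levelStab n ≤ levelStab m := by
  intro g hg v hv
  -- every word of length `m` is a prefix of a word of length `n`
  have hpre : v <+: v ++ List.replicate (n - m) false := List.prefix_append _ _
  have h := (g.2.2 _ _).2 hpre
  rw [hg (v ++ List.replicate (n - m) false)
    (by simp only [List.length_append, List.length_replicate]; omega)] at h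
  exact (List.prefix_of_prefix_length_le h hpre (length_apply g v).le).eq_of_length
    (length_apply g v)

theorem rootedA_notMem_levelStab {n : ℕ} (hn : 1 ≤ n) : rootedA ∉ levelStab n :=
  fun h => rootedA_notMem_levelStab_one (levelStab_anti hn h)

theorem rootedA_mul_notMem {g : treeAut} (hg : g ∈ levelStab 1) : rootedA * g ∉ levelStab 1 := by
  rw [Subgroup.mul_mem_cancel_right _ hg]
  exact rootedA_notMem_levelStab_one

/-- A directed automorphism acts non-trivially on the level `n` as soon as one of the letters that
govern its action there is different from its own. -/
theorem directed_notMem_levelStab {k : Fin 3} {ω : ℕ → Fin 3} {n s : ℕ} (hs : ω s ≠ k)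
    (hn : s + 2 ≤ n) : directed k ω ∉ levelStab n := by
  induction s generalizing ω n with
  | zero =>
    obtain ⟨n, rfl⟩ := Nat.exists_eq_add_of_le' (show 1 ≤ n by omega)
    rw [directed_eq, if_neg hs, pair_mem_levelStab]
    exact fun h => rootedA_notMem_levelStab (by omega) h.1
  | succ s ih =>
    obtain ⟨n, rfl⟩ := Nat.exists_eq_add_of_le' (show 1 ≤ n by omega)
    rw [directed_eq, pair_mem_levelStab]
    exact fun h => ih (ω := shift ω) hs (by omega) h.2

/-- The action on each level has `2`-power exponent. -/
theorem pow_mem_levelStab (g : treeAut) (n : ℕ) : g ^ 2 ^ n ∈ levelStab n := by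
  induction n generalizing g with
  | zero => simp [levelStab_zero]
  | succ n ih =>
    obtain ⟨f, f', hf⟩ : ∃ f f', g ^ 2 = pair f f' := by
      obtain ⟨f, f', rfl | rfl⟩ := exists_eq_pair g
      · exact ⟨_, _, pair_pow f f' 2⟩
      · refine ⟨f * f', f' * f, ?_⟩
        rw [pow_two, mul_assoc, ← mul_assoc rootedA, rootedA_mul_pair, mul_assoc,
          rootedA_mul_self, mul_one, pair_mul]
    rw [pow_succ', pow_mul, hf, pair_pow]
    exact pair_mem_levelStab.2 ⟨ih f, ih f'⟩

/-! ### Conjugacy modulo a level stabiliser -/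

/-- The actions of `f` and `g` on the level `n` are conjugate under the full automorphism group
of the tree. -/
def ConjMod (n : ℕ) (f g : treeAut) : Prop :=
  IsConj (f : treeAut ⧸ levelStab n) (g : treeAut ⧸ levelStab n)

namespace ConjMod

variable {n : ℕ} {f g h f' g' : treeAut}

theorem symm (h : ConjMod n f g) : ConjMod n g f := IsConj.symm h

theorem trans (h₁ : ConjMod n f g) (h₂ : ConjMod n g h) : ConjMod n f h := IsConj.trans h₁ h₂

theorem refl (n : ℕ) (f : treeAut) : ConjMod n f f := IsConj.refl _

theorem of_isConj (n : ℕ) (h : IsConj f g) : ConjMod n f g :=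
  (QuotientGroup.mk' (levelStab n)).map_isConj h

/-- The stabilisers of the levels up to `n` are unions of conjugacy classes modulo the stabiliser
of the level `n`. -/
theorem mem_iff_of_le {m : ℕ} (h : ConjMod n f g) (hm : m ≤ n) :
    f ∈ levelStab m ↔ g ∈ levelStab m := by
  obtain ⟨c, hc⟩ := isConj_iff.1 h
  induction c using QuotientGroup.induction_on with | H c =>
  have h1 : (c * f * c⁻¹)⁻¹ * g ∈ levelStab n := QuotientGroup.eq.1 hc
  have h2 := levelStab_anti hm h1
  have h3 : c * f * c⁻¹ ∈ levelStab m ↔ f ∈ levelStab m :=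
    (levelStab_normal m).mem_comm_iff.trans (by rw [inv_mul_cancel_left])
  rw [← h3]
  refine ⟨fun h => ?_, fun h => ?_⟩
  · simpa only [mul_inv_cancel_left] using mul_mem h h2
  · exact inv_mem_iff.1 ((Subgroup.mul_mem_cancel_right _ h).1 h2)

theorem mem_iff (h : ConjMod n f g) : f ∈ levelStab n ↔ g ∈ levelStab n := h.mem_iff_of_le le_rfl

theorem exists_apply (h : ConjMod n f g) :
    ∃ c : treeAut, ∀ v : List Bool, v.length = n → c.1 (f.1 v) = g.1 (c.1 v) := by
  obtain ⟨c, hc⟩ := isConj_iff.1 h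
  induction c using QuotientGroup.induction_on with | H c =>
  rw [mul_inv_eq_iff_eq_mul] at hc
  have h1 : (g * c)⁻¹ * (c * f) ∈ levelStab n := QuotientGroup.eq.1 hc.symm
  refine ⟨c, fun v hv => ?_⟩
  have := h1 v hv
  change ((g * c).1)⁻¹ ((c * f).1 v) = v at this
  rwa [Equiv.Perm.inv_eq_iff_eq] at this

theorem of_apply (c : treeAut)
    (h : ∀ v : List Bool, v.length = n → c.1 (f.1 v) = g.1 (c.1 v)) : ConjMod n f g := by
  refine isConj_iff.2 ⟨(c : treeAut ⧸ levelStab n), ?_⟩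
  rw [mul_inv_eq_iff_eq_mul]
  refine (QuotientGroup.eq.2 (fun v hv => ?_) : ((g * c : treeAut) : treeAut ⧸ levelStab n) =
    (c * f : treeAut)).symm
  change ((g * c).1)⁻¹ ((c * f).1 v) = v
  rw [Equiv.Perm.inv_eq_iff_eq]
  exact h v hv

/-- Automorphisms fixing the first level are conjugate only if their sections are, possibly after
the sections of one of them are swapped. -/
theorem pair_cases (h : ConjMod (n + 1) (pair f g) (pair f' g')) :
    (ConjMod n f f' ∧ ConjMod n g g') ∨ (ConjMod n f g' ∧ ConjMod n g f') := by
  obtain ⟨c, hc⟩ := h.exists_apply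
  have h0 : ∀ v : List Bool, v.length = n →
      c.1 (false :: f.1 v) = (pair f' g').1 (c.1 (false :: v)) :=
    fun v hv => hc (false :: v) (by simp [hv])
  have h1 : ∀ v : List Bool, v.length = n →
      c.1 (true :: g.1 v) = (pair f' g').1 (c.1 (true :: v)) :=
    fun v hv => hc (true :: v) (by simp [hv])
  obtain ⟨p, q, rfl | rfl⟩ := exists_eq_pair c
  · refine Or.inl ⟨of_apply p fun v hv => ?_, of_apply q fun v hv => ?_⟩
    · exact List.tail_eq_of_cons_eq (h0 v hv)
    · exact List.tail_eq_of_cons_eq (h1 v hv)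
  · refine Or.inr ⟨of_apply q fun v hv => ?_, of_apply p fun v hv => ?_⟩
    · exact List.tail_eq_of_cons_eq (h0 v hv)
    · exact List.tail_eq_of_cons_eq (h1 v hv)

end ConjMod

/-! ### Involutions in cyclic subgroups -/

/-- Modulo the stabiliser of the level `n`, the automorphism `z` is the involution of the cyclic
`2`-group generated by `t`. -/
structure InvPow (n : ℕ) (t z : treeAut) : Prop where
  eq_pow : ∃ p : ℕ, z = t ^ 2 ^ p
  notMem : z ∉ levelStab n
  sq_mem : z ^ 2 ∈ levelStab n

theorem InvPow.exists_conj {n : ℕ} {t t' z : treeAut} (h : InvPow n t z) (ht : IsConj t t') :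
    ∃ z', InvPow n t' z' ∧ IsConj z z' := by
  obtain ⟨c, rfl⟩ := isConj_iff.1 ht
  obtain ⟨⟨p, hp⟩, h1, h2⟩ := h
  have hc : IsConj z (c * z * c⁻¹) := isConj_iff.2 ⟨c, rfl⟩
  have hc2 : IsConj (z ^ 2) ((c * z * c⁻¹) ^ 2) := isConj_iff.2 ⟨c, by rw [conj_pow]⟩
  exact ⟨c * z * c⁻¹, ⟨⟨p, by rw [hp, conj_pow]⟩, fun h => h1
    ((ConjMod.of_isConj n hc).mem_iff.2 h), (ConjMod.of_isConj n hc2).mem_iff.1 h2⟩, hc⟩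

theorem InvPow.eq_of_mul_self {n : ℕ} {t z : treeAut} (h : InvPow n t z) (ht : t * t = 1) :
    z = t := by
  obtain ⟨⟨_ | p, hp⟩, h1, -⟩ := h
  · simpa using hp
  · refine absurd ?_ h1
    rw [hp, pow_succ', pow_mul, pow_two, ht, one_pow]
    exact one_mem _

/-- The involution attached to `(f, g)` has as its sections the ones attached to `f` and `g`, with
one of them possibly replaced by the identity. -/
theorem InvPow.of_pair {n : ℕ} {f g z : treeAut} (h : InvPow (n + 1) (pair f g) z) :
    ∃ p : ℕ, z = pair (f ^ 2 ^ p) (g ^ 2 ^ p) ∧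
      (f ^ 2 ^ p ∈ levelStab n ∨ InvPow n f (f ^ 2 ^ p)) ∧
      (g ^ 2 ^ p ∈ levelStab n ∨ InvPow n g (g ^ 2 ^ p)) := by
  obtain ⟨⟨p, rfl⟩, h1, h2⟩ := h
  rw [pair_pow] at h1 h2
  rw [pair_pow, pair_mem_levelStab] at h2
  refine ⟨p, pair_pow _ _ _, ?_, ?_⟩
  · by_cases hf : f ^ 2 ^ p ∈ levelStab n
    · exact Or.inl hf
    · exact Or.inr ⟨⟨p, rfl⟩, hf, h2.1⟩
  · by_cases hg : g ^ 2 ^ p ∈ levelStab n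
    · exact Or.inl hg
    · exact Or.inr ⟨⟨p, rfl⟩, hg, h2.2⟩

theorem isConj_mul_rootedA (g : treeAut) : IsConj (g * rootedA) (rootedA * g) :=
  isConj_iff.2 ⟨rootedA, by rw [mul_assoc, mul_inv_cancel_right]⟩

theorem rootedA_mul_pair_sq (f g : treeAut) :
    (rootedA * pair f g) ^ 2 = pair (g * f) (f * g) := by
  rw [pow_two]
  nth_rw 1 [rootedA_mul_pair]
  rw [mul_assoc, ← mul_assoc rootedA, rootedA_mul_self, one_mul, pair_mul]

theorem isConj_mul_swap {G : Type*} [Group G] (f g : G) : IsConj (f * g) (g * f) :=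
  isConj_iff.2 ⟨g, by rw [← mul_assoc, mul_inv_cancel_right]⟩

/-- The square of `t = a (f, g)` is `(g f, f g)`. Hence the involution attached to `t` is `t` itself
or has conjugate sections, the second of which is the involution attached to `f g`. -/
theorem InvPow.of_rootedA_mul_pair {n : ℕ} {f g z : treeAut}
    (h : InvPow (n + 1) (rootedA * pair f g) z) :
    (z = rootedA * pair f g ∧ f * g ∈ levelStab n) ∨
      ∃ u v, z = pair u v ∧ IsConj u v ∧ InvPow n (f * g) v := by
  obtain ⟨⟨_ | p, rfl⟩, h1, h2⟩ := h
  · rw [pow_zero, pow_one, rootedA_mul_pair_sq, pair_mem_levelStab] at h2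
    exact Or.inl ⟨by simp, h2.2⟩
  · rw [pow_succ' 2 p, pow_mul, rootedA_mul_pair_sq, pair_pow] at h1 h2 ⊢
    rw [pair_pow, pair_mem_levelStab] at h2
    have hc := (isConj_mul_swap g f).pow (2 ^ p)
    refine Or.inr ⟨_, _, rfl, hc, ⟨p, rfl⟩, fun hv => h1 ?_, h2.2⟩
    exact pair_mem_levelStab.2 ⟨(ConjMod.of_isConj n hc).mem_iff.2 hv, hv⟩

/-- The case `ω 0 ≠ l` of the recursion for the involution attached to `a x_l`. -/
theorem InvPow.of_ne {n : ℕ} {l : Fin 3} {ω : ℕ → Fin 3} {z : treeAut} (hl : ω 0 ≠ l)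
    (h : InvPow (n + 2) (rootedA * directed l ω) z) :
    ∃ u v, z = pair u v ∧ IsConj u v ∧
      InvPow (n + 1) (rootedA * directed l (shift ω)) v := by
  rw [directed_eq, if_neg hl] at h
  obtain ⟨-, h⟩ | h := h.of_rootedA_mul_pair
  · exact absurd (levelStab_anti (by omega) h)
      (rootedA_mul_notMem (directed_mem_levelStab_one _ _))
  · exact h

/-- The case `ω 0 = l` of the recursion for the involution attached to `a x_l`. -/
theorem InvPow.of_eq {n : ℕ} {l : Fin 3} {ω : ℕ → Fin 3} {z : treeAut} (hl : ω 0 = l)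
    (h : InvPow (n + 1) (rootedA * directed l ω) z) :
    (z = rootedA * directed l ω ∧ directed l (shift ω) ∈ levelStab n) ∨
      z = pair (directed l (shift ω)) (directed l (shift ω)) := by
  rw [directed_eq, if_pos hl] at h ⊢
  obtain ⟨⟨_ | _ | p, rfl⟩, h1, h2⟩ := h
  · rw [pow_zero, pow_one, rootedA_mul_pair_sq, pair_mem_levelStab] at h2
    exact Or.inl ⟨by simp, by simpa using h2.2⟩
  · right
    rw [zero_add, pow_one, rootedA_mul_pair_sq, one_mul, mul_one]
  · refine absurd ?_ h1
    rw [pow_succ', pow_succ', ← mul_assoc, pow_mul, pow_mul, rootedA_mul_pair_sq, one_mul,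
      mul_one, pow_two, pair_mul, directed_mul_self, pair_one_one, one_pow]
    exact one_mem _

theorem InvPow.mem_levelStab_one {n : ℕ} {l : Fin 3} {ω : ℕ → Fin 3} {z : treeAut}
    (hx : directed l ω ∉ levelStab n) (h : InvPow n (rootedA * directed l ω) z) :
    z ∈ levelStab 1 := by
  rcases n with _ | _ | n
  · simp [levelStab_zero] at hx
  · exact absurd (directed_mem_levelStab_one l ω) hx
  · by_cases hl : ω 0 = l
    · obtain ⟨-, h⟩ | rfl := h.of_eq hl
      · rw [directed_eq, if_pos hl, pair_mem_levelStab] at hx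
        exact absurd ⟨one_mem _, h⟩ hx
      · exact pair_mem_levelStab_one _ _
    · obtain ⟨u, v, rfl, -⟩ := h.of_ne hl
      exact pair_mem_levelStab_one _ _

/-- A directed automorphism is never conjugate to the involution attached to some `a x_l`: if the
latter fixes the first level then its two sections are conjugate, whereas the sections of the
former are a rooted automorphism and one that fixes the first level. -/
theorem InvPow.not_conjMod_directed {n : ℕ} {l m : Fin 3} {ω : ℕ → Fin 3} {z : treeAut}
    (h : InvPow (n + 1) (rootedA * directed l ω) z) : ¬ ConjMod (n + 1) (directed m ω) z := by
  intro hc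
  have hz1 : z ∈ levelStab 1 :=
    (hc.mem_iff_of_le (by omega)).1 (directed_mem_levelStab_one m ω)
  have hz := h.notMem
  rw [directed_eq] at h
  obtain ⟨rfl, -⟩ | ⟨u, v, rfl, huv, -⟩ := h.of_rootedA_mul_pair
  · exact rootedA_mul_notMem (pair_mem_levelStab_one _ _) hz1
  rw [directed_eq] at hc
  have huv := ConjMod.of_isConj n huv
  have hu : ConjMod n (if ω 0 = m then 1 else rootedA) u ∧ ConjMod n (directed m (shift ω)) u := by
    obtain ⟨h1, h2⟩ | ⟨h1, h2⟩ := hc.pair_cases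
    · exact ⟨h1, h2.trans huv.symm⟩
    · exact ⟨h1.trans huv.symm, h2⟩
  have hun : u ∉ levelStab n := fun h => hz (pair_mem_levelStab.2 ⟨h, huv.mem_iff.1 h⟩)
  by_cases hm : ω 0 = m
  · rw [if_pos hm] at hu
    exact hun (hu.1.mem_iff.1 (one_mem _))
  · rw [if_neg hm] at hu
    rcases n with _ | n
    · exact hun (by simp [levelStab_zero])
    · exact rootedA_notMem_levelStab_one (((hu.1.trans hu.2.symm).mem_iff_of_le (by omega)).2
        (directed_mem_levelStab_one m _))

/-- The case of `InvPow.not_conjMod` in which the sequence starts with one of the two letters. -/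
theorem InvPow.not_conjMod_of_eq {n : ℕ} {l m : Fin 3} (hlm : l ≠ m) {ω : ℕ → Fin 3}
    {z z' : treeAut} (hl : ω 0 = l) (h : InvPow (n + 2) (rootedA * directed l ω) z)
    (h' : InvPow (n + 2) (rootedA * directed m ω) z') : ¬ ConjMod (n + 2) z z' := by
  intro hc
  obtain ⟨u, v, rfl, huv, hv⟩ := h'.of_ne (by rwa [hl])
  have huv := ConjMod.of_isConj (n + 1) huv
  obtain ⟨rfl, -⟩ | rfl := h.of_eq hl
  · exact rootedA_mul_notMem (directed_mem_levelStab_one l ω)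
      ((hc.mem_iff_of_le (by omega)).2 (pair_mem_levelStab_one u v))
  · obtain ⟨-, h2⟩ | ⟨h1, -⟩ := hc.pair_cases
    · exact hv.not_conjMod_directed h2
    · exact hv.not_conjMod_directed h1

/-- The involutions attached to `a x_l` and `a x_m` for `l ≠ m` are not conjugate, provided that
one of the two letters occurs in the part of `ω` that governs the action on the level `n`. The
first occurrence reduces the claim to `InvPow.not_conjMod_directed`. -/
theorem InvPow.not_conjMod {n s : ℕ} {l m : Fin 3} (hlm : l ≠ m) {ω : ℕ → Fin 3}
    {z z' : treeAut} (hs : ω s = l ∨ ω s = m) (hn : s + 2 ≤ n)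
    (h : InvPow n (rootedA * directed l ω) z)
    (h' : InvPow n (rootedA * directed m ω) z') : ¬ ConjMod n z z' := by
  induction s generalizing ω n z z' with
  | zero =>
    obtain ⟨n, rfl⟩ := Nat.exists_eq_add_of_le' (show 2 ≤ n by omega)
    rcases hs with hs | hs
    · exact h.not_conjMod_of_eq hlm hs h'
    · exact fun hc => h'.not_conjMod_of_eq hlm.symm hs h hc.symm
  | succ s ih =>
    obtain ⟨n, rfl⟩ := Nat.exists_eq_add_of_le' (show 2 ≤ n by omega)
    by_cases hl : ω 0 = l
    · exact h.not_conjMod_of_eq hlm hl h'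
    by_cases hm : ω 0 = m
    · exact fun hc => h'.not_conjMod_of_eq hlm.symm hm h hc.symm
    obtain ⟨u, v, rfl, huv, hv⟩ := h.of_ne hl
    obtain ⟨u', v', rfl, huv', hv'⟩ := h'.of_ne hm
    intro hc
    refine ih (ω := shift ω) hs (by omega) hv hv' ?_
    obtain ⟨-, h2⟩ | ⟨h1, h2⟩ := hc.pair_cases
    · exact h2
    · exact h2.trans (ConjMod.of_isConj _ huv')

/-! ### Conjugacy types -/

/-- Labels for the conjugacy classes that occur among sections: trivial, moving the first level,
directed, and the involution attached to `a x_l`. -/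
inductive Kind
  | one
  | root
  | dir
  | inv (l : Fin 3)

/-- The automorphism `u` acts on the level `n` as prescribed by a label, for the sequence `ω`. Only
letters from `Λ` are allowed in the label `inv l`, since `a x_l` and `a x_m` may be equal modulo
the level stabiliser for `l ≠ m`. -/
def HasKind (Λ : Set (Fin 3)) (n : ℕ) (ω : ℕ → Fin 3) (u : treeAut) : Kind → Prop
  | .one => u ∈ levelStab n
  | .root => u ∉ levelStab 1
  | .dir => ∃ l, directed l ω ∉ levelStab n ∧ ConjMod n (directed l ω) u
  | .inv l => l ∈ Λ ∧ ∃ z, z ∈ levelStab 1 ∧ InvPow n (rootedA * directed l ω) z ∧ ConjMod n z u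

/-- The condition under which the labels for `ω` are mutually exclusive on the level `n` (see
`HasKind.unique`): of any two letters in `Λ`, at least one occurs in the part of `ω` that governs
the action on that level. -/
structure Separates (Λ : Set (Fin 3)) (n : ℕ) (ω : ℕ → Fin 3) : Prop where
  one_le : 1 ≤ n
  exists_eq : ∀ l ∈ Λ, ∀ m ∈ Λ, l ≠ m → ∃ s, (ω s = l ∨ ω s = m) ∧ s + 2 ≤ n

namespace HasKind

variable {Λ : Set (Fin 3)} {n : ℕ} {ω : ℕ → Fin 3} {u v : treeAut} {κ κ' : Kind}

theorem congr (hn : 1 ≤ n) (h : HasKind Λ n ω u κ) (huv : ConjMod n u v) :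
    HasKind Λ n ω v κ := by
  cases κ with
  | one => exact huv.mem_iff.1 h
  | root => exact fun hv => h ((huv.mem_iff_of_le hn).2 hv)
  | dir =>
    obtain ⟨l, hl, hc⟩ := h
    exact ⟨l, hl, hc.trans huv⟩
  | inv l =>
    obtain ⟨hl, z, h1, hz, hc⟩ := h
    exact ⟨hl, z, h1, hz, hc.trans huv⟩

theorem mem_levelStab_one (hn : 1 ≤ n) (h : HasKind Λ n ω u κ) (hκ : κ ≠ .root) :
    u ∈ levelStab 1 := by
  cases κ with
  | one => exact levelStab_anti hn h
  | root => exact absurd rfl hκ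
  | dir =>
    obtain ⟨l, -, hc⟩ := h
    exact (hc.mem_iff_of_le hn).1 (directed_mem_levelStab_one l ω)
  | inv l =>
    obtain ⟨-, z, h1, -, hc⟩ := h
    exact (hc.mem_iff_of_le hn).1 h1

theorem notMem (hn : 1 ≤ n) (h : HasKind Λ n ω u κ) (hκ : κ ≠ .one) : u ∉ levelStab n := by
  cases κ with
  | one => exact absurd rfl hκ
  | root => exact fun hu => h (levelStab_anti hn hu)
  | dir =>
    obtain ⟨l, hl, hc⟩ := h
    exact fun hu => hl (hc.mem_iff.2 hu)
  | inv l =>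
    obtain ⟨-, z, -, hz, hc⟩ := h
    exact fun hu => hz.notMem (hc.mem_iff.2 hu)

theorem dir_not_inv {l : Fin 3} (hn : 1 ≤ n) (h : HasKind Λ n ω u .dir) :
    ¬ HasKind Λ n ω u (.inv l) := by
  obtain ⟨n, rfl⟩ := Nat.exists_eq_add_of_le' hn
  obtain ⟨m, -, hm⟩ := h
  rintro ⟨-, z, -, hz, hc⟩
  exact hz.not_conjMod_directed (hm.trans hc.symm)

theorem unique (hΛ : Separates Λ n ω) (h : HasKind Λ n ω u κ) (h' : HasKind Λ n ω u κ') :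
    κ = κ' := by
  have hn := hΛ.one_le
  by_cases h1 : κ = .root
  · subst h1
    by_contra hκ
    exact h (h'.mem_levelStab_one hn (Ne.symm hκ))
  by_cases h1' : κ' = .root
  · subst h1'
    exact absurd (h.mem_levelStab_one hn h1) h'
  by_cases h2 : κ = .one
  · subst h2
    by_contra hκ
    exact h'.notMem hn (Ne.symm hκ) h
  by_cases h2' : κ' = .one
  · subst h2'
    exact absurd h' (h.notMem hn h2)
  cases κ with
  | one => exact absurd rfl h2
  | root => exact absurd rfl h1
  | dir =>
    cases κ' with
    | one => exact absurd rfl h2'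
    | root => exact absurd rfl h1'
    | dir => rfl
    | inv l => exact absurd h' (h.dir_not_inv hn)
  | inv l =>
    cases κ' with
    | one => exact absurd rfl h2'
    | root => exact absurd rfl h1'
    | dir => exact absurd h (h'.dir_not_inv hn)
    | inv m =>
      obtain ⟨hl, z, -, hz, hc⟩ := h
      obtain ⟨hm, z', -, hz', hc'⟩ := h'
      by_contra hlm
      have hlm : l ≠ m := fun h => hlm (congrArg _ h)
      obtain ⟨s, hs, hsn⟩ := hΛ.exists_eq l hl m hm hlm
      exact hz.not_conjMod hlm hs hsn hz' (hc.trans hc'.symm)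

end HasKind

/-- The type of an automorphism acting on the level `n + 1`: `none` if it moves the first level,
and otherwise the unordered pair of the labels of its two sections. -/
def HasType (Λ : Set (Fin 3)) (n : ℕ) (ω : ℕ → Fin 3) (z : treeAut) : Option (Sym2 Kind) → Prop
  | none => z ∉ levelStab 1
  | some s => ∃ u v κ κ', ConjMod (n + 1) z (pair u v) ∧ HasKind Λ n ω u κ ∧
      HasKind Λ n ω v κ' ∧ s = s(κ, κ')

theorem HasType.congr {Λ : Set (Fin 3)} {n : ℕ} {ω : ℕ → Fin 3} {z z' : treeAut}
    {s : Option (Sym2 Kind)} (h : HasType Λ n ω z s) (hz : ConjMod (n + 1) z z') :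
    HasType Λ n ω z' s := by
  cases s with
  | none => exact fun h' => h ((hz.mem_iff_of_le (by omega)).2 h')
  | some s =>
    obtain ⟨u, v, κ, κ', hc, hr⟩ := h
    exact ⟨u, v, κ, κ', hz.symm.trans hc, hr⟩

theorem HasType.unique {Λ : Set (Fin 3)} {n : ℕ} {ω : ℕ → Fin 3} {z : treeAut}
    {s s' : Option (Sym2 Kind)} (hΛ : Separates Λ n ω) (h : HasType Λ n ω z s)
    (h' : HasType Λ n ω z s') : s = s' := by
  have key : ∀ {s}, HasType Λ n ω z (some s) → z ∈ levelStab 1 := by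
    rintro s ⟨u, v, κ, κ', hc, -⟩
    exact (hc.mem_iff_of_le (by omega)).2 (pair_mem_levelStab_one u v)
  cases s with
  | none =>
    cases s' with
    | none => rfl
    | some s' => exact absurd (key h') h
  | some s =>
    cases s' with
    | none => exact absurd (key h) h'
    | some s' =>
      obtain ⟨u, v, κ, κ', hc, hu, hv, rfl⟩ := h
      obtain ⟨u₁, v₁, κ₁, κ₁', hc₁, hu₁, hv₁, rfl⟩ := h'
      have hn := hΛ.one_le
      obtain ⟨h1, h2⟩ | ⟨h1, h2⟩ := (hc.symm.trans hc₁).pair_cases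
      · rw [(hu.congr hn h1).unique hΛ hu₁, (hv.congr hn h2).unique hΛ hv₁]
      · rw [(hu.congr hn h1).unique hΛ hv₁, (hv.congr hn h2).unique hΛ hu₁, Sym2.eq_swap]

/-- The set `S` contains the type of the involution in the cyclic group generated by `t`, modulo
the stabiliser of the level `n + 1`. -/
def InvTypes (Λ : Set (Fin 3)) (n : ℕ) (ω : ℕ → Fin 3) (t : treeAut)
    (S : Set (Option (Sym2 Kind))) : Prop :=
  ∀ z, InvPow (n + 1) t z → ∃ s ∈ S, HasType Λ n ω z s

namespace InvTypes

variable {Λ : Set (Fin 3)} {n : ℕ} {ω : ℕ → Fin 3} {t t' : treeAut}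
  {S S' : Set (Option (Sym2 Kind))}

theorem of_isConj (h : InvTypes Λ n ω t S) (ht : IsConj t' t) : InvTypes Λ n ω t' S := by
  intro z hz
  obtain ⟨z', hz', hc⟩ := hz.exists_conj ht
  obtain ⟨s, hs, hs'⟩ := h z' hz'
  exact ⟨s, hs, hs'.congr (ConjMod.of_isConj _ hc).symm⟩

theorem inv (h : InvTypes Λ n ω t S) : InvTypes Λ n ω t⁻¹ S := by
  rintro z ⟨⟨p, hp⟩, h1, h2⟩
  obtain ⟨s, hs, hs'⟩ := h z⁻¹ ⟨⟨p, by rw [hp, inv_pow, inv_inv]⟩,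
    fun h => h1 (inv_mem_iff.1 h), by rwa [inv_pow, inv_mem_iff]⟩
  refine ⟨s, hs, hs'.congr ?_⟩
  -- `z` and its inverse agree modulo the stabiliser
  have : ((z⁻¹ : treeAut) : treeAut ⧸ levelStab (n + 1)) = (z : treeAut) :=
    QuotientGroup.eq.2 (by rwa [inv_inv, ← pow_two])
  unfold ConjMod
  rw [this]

/-- Involutions of different types are not conjugate. -/
theorem not_conjMod (hΛ : Separates Λ n ω) (h : InvTypes Λ n ω t S) (h' : InvTypes Λ n ω t' S')
    (hS : Disjoint S S') {z z' : treeAut} (hz : InvPow (n + 1) t z) (hz' : InvPow (n + 1) t' z') :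
    ¬ ConjMod (n + 1) z z' := by
  intro hc
  obtain ⟨s, hs, hs'⟩ := h z hz
  obtain ⟨r, hr, hr'⟩ := h' z' hz'
  obtain rfl := (hs'.congr hc).unique hΛ hr'
  exact Set.disjoint_left.1 hS hs hr

end InvTypes

/-! ### The types of the involutions attached to the generators -/

section Types

variable {Λ : Set (Fin 3)} {n : ℕ} {ω : ℕ → Fin 3} {i l : Fin 3}

theorem InvPow.hasKind {z : treeAut} (hl : l ∈ Λ) (hx : directed l ω ∉ levelStab n)
    (hz : InvPow n (rootedA * directed l ω) z) : HasKind Λ n ω z (.inv l) :=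
  ⟨hl, z, hz.mem_levelStab_one hx, hz, ConjMod.refl _ _⟩

theorem hasKind_directed (hx : directed l ω ∉ levelStab n) :
    HasKind Λ n ω (directed l ω) .dir :=
  ⟨l, hx, ConjMod.refl _ _⟩

theorem hasKind_rootedA : HasKind Λ n ω rootedA .root := rootedA_notMem_levelStab_one

theorem hasKind_of_mem {u : treeAut} (hu : u ∈ levelStab n) : HasKind Λ n ω u .one := hu

theorem hasType_pair {u v : treeAut} {κ κ' : Kind} (hu : HasKind Λ n ω u κ)
    (hv : HasKind Λ n ω v κ') : HasType Λ n ω (pair u v) (some s(κ, κ')) :=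
  ⟨u, v, κ, κ', ConjMod.refl _ _, hu, hv, rfl⟩

theorem invTypes_rootedA : InvTypes Λ n ω rootedA {none} := by
  intro z hz
  rw [hz.eq_of_mul_self rootedA_mul_self]
  exact ⟨none, rfl, rootedA_notMem_levelStab_one⟩

theorem invTypes_directed_of_eq (hl : ω 0 = l) (hx : directed l (shift ω) ∉ levelStab n) :
    InvTypes Λ n (shift ω) (directed l ω) {some s(.one, .dir)} := by
  intro z hz
  rw [hz.eq_of_mul_self (directed_mul_self l ω), directed_eq, if_pos hl]
  exact ⟨_, rfl, hasType_pair (hasKind_of_mem (one_mem _)) (hasKind_directed hx)⟩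

theorem invTypes_directed_of_ne (hl : ω 0 ≠ l) (hx : directed l (shift ω) ∉ levelStab n) :
    InvTypes Λ n (shift ω) (directed l ω) {some s(.root, .dir)} := by
  intro z hz
  rw [hz.eq_of_mul_self (directed_mul_self l ω), directed_eq, if_neg hl]
  exact ⟨_, rfl, hasType_pair hasKind_rootedA (hasKind_directed hx)⟩

theorem invTypes_rootedA_mul_directed_of_eq (hl : ω 0 = l)
    (hx : directed l (shift ω) ∉ levelStab n) :
    InvTypes Λ n (shift ω) (rootedA * directed l ω) {some s(.dir, .dir)} := by
  intro z hz
  obtain ⟨-, h⟩ | rfl := hz.of_eq hl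
  · exact absurd h hx
  · exact ⟨_, rfl, hasType_pair (hasKind_directed hx) (hasKind_directed hx)⟩

theorem invTypes_rootedA_mul_directed_of_ne (hn : 1 ≤ n) (hl : ω 0 ≠ l) (hlΛ : l ∈ Λ)
    (hx : directed l (shift ω) ∉ levelStab n) :
    InvTypes Λ n (shift ω) (rootedA * directed l ω) {some s(.inv l, .inv l)} := by
  intro z hz
  obtain ⟨n, rfl⟩ := Nat.exists_eq_add_of_le' hn
  obtain ⟨u, v, rfl, huv, hv⟩ := hz.of_ne hl
  have hk := hv.hasKind hlΛ hx
  exact ⟨_, rfl, hasType_pair (hk.congr hn (ConjMod.of_isConj _ huv).symm) hk⟩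

/-- The square of `a x_l` is non-trivial on every level on which `x_l` is non-trivial. -/
theorem rootedA_mul_directed_sq_notMem (hx : directed l ω ∉ levelStab n) :
    (rootedA * directed l ω) ^ 2 ∉ levelStab n := by
  intro h
  have hn : 1 ≤ n := by
    by_contra hn
    obtain rfl : n = 0 := by omega
    simp [levelStab_zero] at hx
  have ha := rootedA_mul_notMem (directed_mem_levelStab_one l ω)
  have hz : InvPow n (rootedA * directed l ω) (rootedA * directed l ω) :=
    ⟨⟨0, by simp⟩, fun h => ha (levelStab_anti hn h), h⟩
  exact ha (hz.mem_levelStab_one hx)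

theorem invTypes_pair_involution {f : treeAut} (hf : f * f = 1) (hlΛ : l ∈ Λ)
    (hx : directed l ω ∉ levelStab n) :
    InvTypes Λ n ω (pair f (rootedA * directed l ω)) {some s(.one, .inv l)} := by
  intro z hz
  have hz1 := hz.notMem
  have hz2 := hz.sq_mem
  obtain ⟨_ | p, rfl, -, hv⟩ := hz.of_pair
  · rw [pair_pow, pair_mem_levelStab, pow_zero, pow_one] at hz2
    exact absurd hz2.2 (rootedA_mul_directed_sq_notMem hx)
  · have hf1 : f ^ 2 ^ (p + 1) = 1 := by
      rw [pow_succ', pow_mul, pow_two, hf, one_pow]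
    rw [hf1] at hz1 ⊢
    obtain hv | hv := hv
    · exact absurd (pair_mem_levelStab.2 ⟨one_mem _, hv⟩) hz1
    · exact ⟨_, rfl, hasType_pair (hasKind_of_mem (one_mem _)) (hv.hasKind hlΛ hx)⟩

theorem rootedA_mul_directed_mul (hi : ω 0 ≠ i) :
    rootedA * directed i ω * rootedA * directed l ω =
      pair (directed i (shift ω) * if ω 0 = l then 1 else rootedA)
        (rootedA * directed l (shift ω)) := by
  rw [directed_eq i, directed_eq l, if_neg hi, rootedA_mul_pair, mul_assoc (pair _ _),
    rootedA_mul_self, mul_one, pair_mul]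

/-- With `ω 0 = l` the word `a x_i a x_l` is `(x_i', a x_l')`, and the first section is too short to
contribute to the involution. -/
theorem invTypes_four_of_eq (hi : ω 0 ≠ i) (hl : ω 0 = l) (hlΛ : l ∈ Λ)
    (hx : directed l (shift ω) ∉ levelStab n) :
    InvTypes Λ n (shift ω) (rootedA * directed i ω * rootedA * directed l ω)
      {some s(.one, .inv l)} := by
  rw [rootedA_mul_directed_mul hi, if_pos hl, mul_one]
  exact invTypes_pair_involution (directed_mul_self _ _) hlΛ hx

/-- With `ω 0 ≠ l` the word `a x_i a x_l` is `(x_i' a, a x_l')`. Which sections of the involution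
are non-trivial depends on the orders of `x_i' a` and `a x_l'`; all three possibilities are
allowed. -/
theorem invTypes_four_of_ne (hn : 1 ≤ n) (hi : ω 0 ≠ i) (hl : ω 0 ≠ l) (hiΛ : i ∈ Λ)
    (hlΛ : l ∈ Λ) (hxi : directed i (shift ω) ∉ levelStab n)
    (hxl : directed l (shift ω) ∉ levelStab n) :
    InvTypes Λ n (shift ω) (rootedA * directed i ω * rootedA * directed l ω)
      {some s(.inv i, .inv l), some s(.one, .inv l), some s(.inv i, .one)} := by
  rw [rootedA_mul_directed_mul hi, if_neg hl]
  intro z hz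
  have hz1 := hz.notMem
  obtain ⟨p, rfl, hu, hv⟩ := hz.of_pair
  have hu' : (directed i (shift ω) * rootedA) ^ 2 ^ p ∈ levelStab n ∨
      HasKind Λ n (shift ω) ((directed i (shift ω) * rootedA) ^ 2 ^ p) (.inv i) := by
    refine hu.imp_right fun hu => ?_
    obtain ⟨w, hw, hc⟩ := hu.exists_conj (isConj_mul_rootedA _)
    exact (hw.hasKind hiΛ hxi).congr hn (ConjMod.of_isConj n hc).symm
  have hv' := hv.imp_right fun hv => hv.hasKind hlΛ hxl
  rcases hu' with hu' | hu' <;> rcases hv' with hv' | hv'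
  · exact absurd (pair_mem_levelStab.2 ⟨hu', hv'⟩) hz1
  · exact ⟨_, by simp, hasType_pair (hasKind_of_mem hu') hv'⟩
  · exact ⟨some s(.inv i, .one), by simp, hasType_pair hu' (hasKind_of_mem hv')⟩
  · exact ⟨_, by simp, hasType_pair hu' hv'⟩

end Types

/-! ### Constant tails -/

section Constant

variable {Λ : Set (Fin 3)} {n : ℕ} {ω : ℕ → Fin 3} {i j k : Fin 3}

/-- If `τ` is constant with value `i`, then `x_i` is trivial, as no vertex carries a swap. -/
theorem directed_eq_one {τ : ℕ → Fin 3} (h : ∀ m, τ m = i) : directed i τ = 1 := by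
  ext1 v
  induction v generalizing τ with
  | nil => rfl
  | cons x v ih =>
    rw [directed_eq, if_pos (h 0)]
    cases x
    · rfl
    · exact congrArg _ (ih fun m => h (m + 1))

theorem directed_eq_pair_of_const (hi : ω 0 ≠ i) (h : ∀ m, shift ω m = i) :
    directed i ω = pair rootedA 1 := by
  rw [directed_eq, if_neg hi, directed_eq_one h]

theorem invTypes_const_rootedA_mul (hn : 1 ≤ n) :
    InvTypes Λ n (shift ω) (rootedA * pair rootedA 1) {some s(.root, .root)} := by
  rintro z ⟨⟨_ | _ | p, rfl⟩, h1, h2⟩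
  · rw [pow_zero, pow_one, rootedA_mul_pair_sq, pair_mem_levelStab, one_mul] at h2
    exact absurd h2.1 (rootedA_notMem_levelStab hn)
  · rw [zero_add, pow_one, rootedA_mul_pair_sq, one_mul, mul_one]
    exact ⟨_, rfl, hasType_pair hasKind_rootedA hasKind_rootedA⟩
  · refine absurd ?_ h1
    rw [pow_succ', pow_succ', ← mul_assoc, pow_mul, pow_mul, rootedA_mul_pair_sq, one_mul,
      mul_one, pow_two, pair_mul, rootedA_mul_self, pair_one_one, one_pow]
    exact one_mem _

theorem invTypes_const_directed :
    InvTypes Λ n (shift ω) (pair rootedA 1) {some s(.root, .one)} := by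
  intro z hz
  rw [hz.eq_of_mul_self (by rw [pair_mul, rootedA_mul_self, one_mul, pair_one_one])]
  exact ⟨_, rfl, hasType_pair hasKind_rootedA (hasKind_of_mem (one_mem _))⟩

theorem invTypes_const_four (hk : ω 0 = k) (hkΛ : k ∈ Λ)
    (hx : directed k (shift ω) ∉ levelStab n) :
    InvTypes Λ n (shift ω) (rootedA * directed k ω * rootedA * pair rootedA 1)
      {some s(.one, .inv k)} := by
  refine (invTypes_pair_involution (one_mul 1) hkΛ hx).of_isConj ?_
  rw [directed_eq, if_pos hk, rootedA_mul_pair, mul_assoc (pair _ _), rootedA_mul_self, mul_one]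
  refine (isConj_mul_swap _ _).trans (isConj_iff.2 ⟨rootedA, ?_⟩)
  rw [pair_mul, rootedA_mul_pair, mul_inv_cancel_right, mul_one]

/-- When `x_i' = 1`, the word `a x_j a x_k a x_i` squares to an element with second section
`(a x_k') ^ 2` and first section conjugate to it. -/
theorem invTypes_const_six (hn : 1 ≤ n) (hk : ω 0 = k) (hj : ω 0 ≠ j)
    (hjk : directed j (shift ω) = directed k (shift ω)) (hkΛ : k ∈ Λ)
    (hx : directed k (shift ω) ∉ levelStab n) :
    InvTypes Λ n (shift ω)
      (rootedA * directed j ω * rootedA * directed k ω * rootedA * pair rootedA 1)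
      {some s(.inv k, .inv k)} := by
  rw [rootedA_mul_directed_mul hj, if_pos hk, mul_one, hjk, ← rootedA_mul_pair,
    mul_assoc rootedA, pair_mul, mul_one]
  intro z hz
  have hsq : rootedA * directed k (shift ω) * rootedA * directed k (shift ω) =
      (rootedA * directed k (shift ω)) ^ 2 := by rw [pow_two, mul_assoc (_ * _)]
  obtain ⟨-, h⟩ | ⟨u, v, rfl, huv, ⟨p, hp⟩, h1, h2⟩ := hz.of_rootedA_mul_pair
  · rw [hsq] at h
    exact absurd h (rootedA_mul_directed_sq_notMem hx)
  · rw [hsq, ← pow_mul, ← pow_succ'] at hp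
    have hv := InvPow.hasKind hkΛ hx ⟨⟨p + 1, hp⟩, h1, h2⟩
    exact ⟨_, rfl, hasType_pair (hv.congr hn (ConjMod.of_isConj n huv).symm) hv⟩

end Constant

/-! ### Disjointness of tuples -/

section Disjoint

/-- The unique involution of a cyclic `2`-group is found among the iterated squares of a
generator. -/
theorem exists_eq_pow_two_pow {H : Type*} [Group H] {t y : H} {N : ℕ} (ht : t ^ 2 ^ N = 1)
    (hy : y ∈ Subgroup.zpowers t) (h1 : y ≠ 1) (h2 : y ^ 2 = 1) : ∃ p : ℕ, y = t ^ 2 ^ p := by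
  obtain ⟨e, -, he⟩ := (Nat.dvd_prime_pow Nat.prime_two).1 (orderOf_dvd_of_pow_eq_one ht)
  obtain ⟨m, rfl⟩ := Subgroup.mem_zpowers_iff.1 hy
  have h3 : ((orderOf t : ℕ) : ℤ) ∣ m * 2 := by
    rw [orderOf_dvd_iff_zpow_eq_one, zpow_mul]
    exact_mod_cast h2
  rcases e with _ | e
  · rw [pow_zero, orderOf_eq_one_iff] at he
    simp [he] at h1
  rw [he, pow_succ] at h3
  push_cast at h3
  obtain ⟨q, rfl⟩ := Int.dvd_of_mul_dvd_mul_right (by norm_num) h3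
  have h4 : t ^ (2 ^ e * 2) = 1 := by rw [← pow_succ, ← he, pow_orderOf_eq_one]
  refine ⟨e, ?_⟩
  rcases Int.even_or_odd' q with ⟨c, rfl | rfl⟩
  · refine absurd ?_ h1
    rw [← mul_assoc, zpow_mul]
    have : t ^ ((2 : ℤ) ^ e * 2) = 1 := by exact_mod_cast h4
    rw [this, one_zpow]
  · have : t ^ ((2 : ℤ) ^ e * 2) = 1 := by exact_mod_cast h4
    rw [mul_add, ← mul_assoc, zpow_add, zpow_mul, this, one_zpow, one_mul, mul_one]
    exact_mod_cast rfl

variable (ω : ℕ → Fin 3) (n : ℕ)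

/-- The embedding (see `toFull_injective`) of `G_ω / St(n)` into the quotient of the full
automorphism group of the tree. -/
def toFull : levelQuotient ω n →* treeAut ⧸ levelStab n :=
  QuotientGroup.map _ _ (grigorchukGroup ω).subtype fun _ h => h

theorem toFull_injective : Function.Injective (toFull ω n) := by
  intro x y h
  induction x using QuotientGroup.induction_on with | H x =>
  induction y using QuotientGroup.induction_on with | H y =>
  exact QuotientGroup.eq.2 (Subgroup.mem_subgroupOf.2 (QuotientGroup.eq.1 h))

theorem levelQuotient_pow (x : levelQuotient ω n) : x ^ 2 ^ n = 1 := by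
  induction x using QuotientGroup.induction_on with | H x =>
  exact (QuotientGroup.eq_one_iff _).2 (Subgroup.mem_subgroupOf.2 (pow_mem_levelStab x.1 n))

theorem levelQuotient_isPGroup : IsPGroup 2 (levelQuotient ω n) :=
  fun x => ⟨n, levelQuotient_pow ω n x⟩

/-- An automorphism is determined modulo the stabiliser of the level `n` by the permutation of
the finite set of words of length `n`. -/
theorem levelQuotient_finite : Finite (levelQuotient ω n) := by
  have : Finite {v : List Bool // v.length = n} := inferInstanceAs (Finite (List.Vector Bool n))
  let F : treeAut ⧸ levelStab n →
      ({v : List Bool // v.length = n} → {v : List Bool // v.length = n}) :=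
    fun q => Quotient.out q |> fun g v => ⟨g.1 v, (length_apply g v).trans v.2⟩
  have hF : Function.Injective F := by
    intro x y h
    rw [← QuotientGroup.out_eq' x, ← QuotientGroup.out_eq' y]
    refine QuotientGroup.eq.2 fun v hv => ?_
    change ((Quotient.out x).1)⁻¹ ((Quotient.out y).1 v) = v
    rw [Equiv.Perm.inv_eq_iff_eq]
    exact (congrArg Subtype.val (congrFun h ⟨v, hv⟩)).symm
  have := Finite.of_injective F hF
  exact Finite.of_injective _ (toFull_injective ω n)

variable {ω n}

/-- Since the groups are `2`-groups, it suffices for the disjointness of two tuples that the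
involutions attached to their entries are never conjugate. -/
theorem conjCyclic_inter {r₁ r₂ : ℕ} (hr₁ : 0 < r₁) (hr₂ : 0 < r₂)
    {T₁ : Fin r₁ → levelQuotient ω n} {T₂ : Fin r₂ → levelQuotient ω n}
    {t₁ : Fin r₁ → treeAut} {t₂ : Fin r₂ → treeAut}
    (h₁ : ∀ i, toFull ω n (T₁ i) = (t₁ i : treeAut ⧸ levelStab n))
    (h₂ : ∀ i, toFull ω n (T₂ i) = (t₂ i : treeAut ⧸ levelStab n))
    (h : ∀ i j z z', InvPow n (t₁ i) z → InvPow n (t₂ j) z' → ¬ ConjMod n z z') :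
    conjCyclic T₁ ∩ conjCyclic T₂ = {1} := by
  have key : ∀ {t : levelQuotient ω n} {t' : treeAut} {y : levelQuotient ω n},
      toFull ω n t = (t' : treeAut ⧸ levelStab n) → y ∈ Subgroup.zpowers t → y ≠ 1 →
      y ^ 2 = 1 → ∃ z, InvPow n t' z ∧ toFull ω n y = (z : treeAut ⧸ levelStab n) := by
    intro t t' y ht hy h1 h2
    obtain ⟨p, rfl⟩ := exists_eq_pow_two_pow (levelQuotient_pow ω n t) hy h1 h2
    have hy : toFull ω n (t ^ 2 ^ p) = ((t' ^ 2 ^ p : treeAut) : treeAut ⧸ levelStab n) := by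
      rw [map_pow, ht]
      rfl
    refine ⟨t' ^ 2 ^ p, ⟨⟨p, rfl⟩, fun hm => h1 (toFull_injective ω n ?_), ?_⟩, hy⟩
    · rw [hy, map_one, (QuotientGroup.eq_one_iff _).2 hm]
    · rw [← QuotientGroup.eq_one_iff, QuotientGroup.mk_pow, ← hy, ← map_pow, h2, map_one]
  refine Set.eq_singleton_iff_unique_mem.2 ⟨⟨⟨1, ⟨0, hr₁⟩, 1, one_mem _, by simp⟩,
    ⟨1, ⟨0, hr₂⟩, 1, one_mem _, by simp⟩⟩, ?_⟩
  rintro x ⟨⟨g, i, y, hy, hx⟩, ⟨g', j, y', hy', hx'⟩⟩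
  by_contra hx1
  obtain ⟨e, -, he⟩ := (Nat.dvd_prime_pow Nat.prime_two).1
    (orderOf_dvd_of_pow_eq_one (levelQuotient_pow ω n x))
  rcases e with _ | e
  · exact hx1 (orderOf_eq_one_iff.1 he)
  have hxe : x ^ 2 ^ e ≠ 1 := pow_ne_one_of_lt_orderOf (by positivity)
    (by rw [he]; exact Nat.pow_lt_pow_right (by norm_num) (by omega))
  have hxe2 : (x ^ 2 ^ e) ^ 2 = 1 := by rw [← pow_mul, ← pow_succ, ← he, pow_orderOf_eq_one]
  have conj : ∀ {g y : levelQuotient ω n}, x = g⁻¹ * y * g → IsConj (x ^ 2 ^ e) (y ^ 2 ^ e) :=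
    fun {g y} h => IsConj.pow _ (isConj_iff.2 ⟨g, by rw [h]; group⟩)
  have hc := conj hx
  have hc' := conj hx'
  have inv : ∀ {w : levelQuotient ω n}, IsConj (x ^ 2 ^ e) w → w ≠ 1 ∧ w ^ 2 = 1 := by
    intro w hw
    refine ⟨fun h => hxe ?_, ?_⟩
    · rw [h] at hw
      exact isConj_one_right.1 hw.symm
    · have := hw.pow 2
      rw [hxe2] at this
      exact isConj_one_right.1 this
  -- the involution in `⟨x⟩` is conjugate to the one in `⟨T₁ i⟩` and to the one in `⟨T₂ j⟩`
  obtain ⟨z, hz, hyz⟩ := key (h₁ i) (pow_mem hy _) (inv hc).1 (inv hc).2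
  obtain ⟨z', hz', hyz'⟩ := key (h₂ j) (pow_mem hy' _) (inv hc').1 (inv hc').2
  refine h i j z z' hz hz' ?_
  have := (toFull ω n).map_isConj (hc.symm.trans hc')
  rwa [hyz, hyz'] at this

end Disjoint

/-! ### Products and generation -/

section Words

variable {G : Type*} [Group G] {a b c d : G}

theorem tupleT₁_prod (h : b * c = d) : (List.ofFn (tupleT₁ a b c d)).prod = 1 := by
  subst h
  simp only [tupleT₁, List.ofFn_succ, List.ofFn_zero, List.prod_cons, List.prod_nil,
    Matrix.cons_val_zero, Matrix.cons_val_succ]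
  group

theorem tupleT₂_prod (h : c * c = 1) : (List.ofFn (tupleT₂ a c d)).prod = 1 := by
  simp only [tupleT₂, List.ofFn_succ, List.ofFn_zero, List.prod_cons, List.prod_nil,
    Matrix.cons_val_zero, Matrix.cons_val_succ]
  rw [← mul_assoc (a * c) c, mul_assoc a c c, h]
  group

theorem tupleS₁_prod (h : b * c = d) : (List.ofFn (tupleS₁ a b c d)).prod = 1 := by
  subst h
  simp only [tupleS₁, List.ofFn_succ, List.ofFn_zero, List.prod_cons, List.prod_nil,
    Matrix.cons_val_zero, Matrix.cons_val_succ]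
  group

theorem tupleS₂_prod (h : b * d = c) : (List.ofFn (tupleS₂ a b c d)).prod = 1 := by
  subst h
  simp only [tupleS₂, List.ofFn_succ, List.ofFn_zero, List.prod_cons, List.prod_nil,
    Matrix.cons_val_zero, Matrix.cons_val_succ]
  group

theorem tupleT₁_gen (h : b * c = d) :
    {a, b, c, d} ⊆ (Subgroup.closure (Set.range (tupleT₁ a b c d)) : Set G) := by
  have key := fun i => Subgroup.subset_closure (Set.mem_range_self (f := tupleT₁ a b c d) i)
  have ha : a ∈ _ := key 0
  have hb : b ∈ _ := key 1
  have h2 : c * a * b ∈ _ := key 2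
  have hc : c ∈ _ :=
    (Subgroup.mul_mem_cancel_right _ ha).1 ((Subgroup.mul_mem_cancel_right _ hb).1 h2)
  have hd := mul_mem hb hc
  rw [h] at hd
  simp [Set.insert_subset_iff, ha, hb, hc, hd]

theorem tupleT₂_gen (h : c * d = b) :
    {a, b, c, d} ⊆ (Subgroup.closure (Set.range (tupleT₂ a c d)) : Set G) := by
  have key := fun i => Subgroup.subset_closure (Set.mem_range_self (f := tupleT₂ a c d) i)
  have h0 : a * c ∈ _ := key 0
  have hc : c ∈ _ := key 1
  have h2 : d * a * c ∈ _ := key 2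
  have ha : a ∈ _ := (Subgroup.mul_mem_cancel_right _ hc).1 h0
  have hd : d ∈ _ :=
    (Subgroup.mul_mem_cancel_right _ ha).1 ((Subgroup.mul_mem_cancel_right _ hc).1 h2)
  have hb := mul_mem hc hd
  rw [h] at hb
  simp [Set.insert_subset_iff, ha, hb, hc, hd]

theorem tupleS₁_gen (h : b * c = d) :
    {a, b, c, d} ⊆ (Subgroup.closure (Set.range (tupleS₁ a b c d)) : Set G) := by
  have key := fun i => Subgroup.subset_closure (Set.mem_range_self (f := tupleS₁ a b c d) i)
  have ha : a ∈ _ := key 0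
  have hb : b ∈ _ := key 1
  have hc : c ∈ _ := key 2
  have hd := mul_mem hb hc
  rw [h] at hd
  simp [Set.insert_subset_iff, ha, hb, hc, hd]

theorem tupleS₂_gen (h : b * d = c) :
    {a, b, c, d} ⊆ (Subgroup.closure (Set.range (tupleS₂ a b c d)) : Set G) := by
  have key := fun i => Subgroup.subset_closure (Set.mem_range_self (f := tupleS₂ a b c d) i)
  have h0 : a * b ∈ _ := key 0
  have hd : d ∈ _ := key 1
  have h2 : a * b * a * d ∈ _ := key 2
  have ha : a ∈ _ :=
    (Subgroup.mul_mem_cancel_left _ h0).1 ((Subgroup.mul_mem_cancel_right _ hd).1 h2)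
  have hb : b ∈ _ := (Subgroup.mul_mem_cancel_left _ ha).1 h0
  have hc := mul_mem hb hd
  rw [h] at hc
  simp [Set.insert_subset_iff, ha, hb, hc, hd]

end Words

/-! ### From tree automorphisms to the quotients -/

section Quotient

variable {ω : ℕ → Fin 3} {n : ℕ}

theorem quotDirected_mul_self (l : Fin 3) :
    quotDirected l ω n * quotDirected l ω n = 1 :=
  congrArg QuotientGroup.mk (Subtype.ext (directed_mul_self l ω) :
    (⟨directed l ω, directed_mem l ω⟩ * ⟨directed l ω, directed_mem l ω⟩ :
      grigorchukGroup ω) = 1)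

theorem quotDirected_mul {i j k : Fin 3} (hij : i ≠ j) (hik : i ≠ k) (hjk : j ≠ k) :
    quotDirected i ω n * quotDirected j ω n = quotDirected k ω n :=
  congrArg QuotientGroup.mk (Subtype.ext (directed_mul_directed hij hik hjk ω) :
    (⟨directed i ω, directed_mem i ω⟩ * ⟨directed j ω, directed_mem j ω⟩ :
      grigorchukGroup ω) = ⟨directed k ω, directed_mem k ω⟩)

theorem eq_top_of_generators {K : Subgroup (levelQuotient ω n)} (ha : quotA ω n ∈ K)
    (hx : ∀ l, quotDirected l ω n ∈ K) : K = ⊤ := by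
  refine eq_top_iff.2 fun x _ => ?_
  induction x using QuotientGroup.induction_on with | H x =>
  obtain ⟨x, hmem⟩ := x
  refine Subgroup.closure_induction
    (p := fun g hg => ((⟨g, hg⟩ : grigorchukGroup ω) : levelQuotient ω n) ∈ K)
    ?_ (one_mem K) (fun _ _ _ _ h h' => mul_mem h h') (fun _ _ h => inv_mem h) hmem
  rintro g (rfl | rfl | rfl | rfl)
  exacts [ha, hx 2, hx 1, hx 0]

theorem closure_eq_top {π : Equiv.Perm (Fin 3)} {X : Set (levelQuotient ω n)}
    (h : {quotA ω n, quotDirected (π 2) ω n, quotDirected (π 1) ω n, quotDirected (π 0) ω n} ⊆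
      (Subgroup.closure X : Set (levelQuotient ω n))) : Subgroup.closure X = ⊤ := by
  simp only [Set.insert_subset_iff, Set.singleton_subset_iff] at h
  refine eq_top_of_generators h.1 fun l => ?_
  obtain ⟨m, rfl⟩ := π.surjective l
  fin_cases m
  exacts [h.2.2.2, h.2.2.1, h.2.1]

theorem InvTypes.mono {Λ : Set (Fin 3)} {t : treeAut} {S S' : Set (Option (Sym2 Kind))}
    (h : InvTypes Λ n ω t S) (hS : S ⊆ S') : InvTypes Λ n ω t S' := fun z hz =>
  let ⟨s, hs, hs'⟩ := h z hz
  ⟨s, hS hs, hs'⟩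

theorem isSphericalSystem_of_lift {T : Fin 4 → levelQuotient ω n} {t : Fin 4 → treeAut}
    (hT : ∀ i, toFull ω n (T i) = (t i : treeAut ⧸ levelStab n))
    (hne : ∀ i, t i ∉ levelStab n) (hgen : Subgroup.closure (Set.range T) = ⊤)
    (hprod : (List.ofFn T).prod = 1) : IsSphericalSystem T where
  three_le := by norm_num
  ne_one i hi := by
    have := hT i
    rw [hi, map_one] at this
    exact hne i ((QuotientGroup.eq_one_iff _).1 this.symm)
  generates := hgen
  prod_eq_one := hprod

theorem isRamificationStructure_of_types {Λ : Set (Fin 3)} {τ : ℕ → Fin 3}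
    {T₁ T₂ : Fin 4 → levelQuotient ω (n + 1)} {t₁ t₂ : Fin 4 → treeAut}
    (hT₁ : ∀ i, toFull ω (n + 1) (T₁ i) = (t₁ i : treeAut ⧸ levelStab (n + 1)))
    (hT₂ : ∀ i, toFull ω (n + 1) (T₂ i) = (t₂ i : treeAut ⧸ levelStab (n + 1)))
    (hS₁ : IsSphericalSystem T₁) (hS₂ : IsSphericalSystem T₂)
    (hΛ : Separates Λ n τ) {A B : Set (Option (Sym2 Kind))} (hAB : Disjoint A B)
    (hA : ∀ i, InvTypes Λ n τ (t₁ i) A) (hB : ∀ i, InvTypes Λ n τ (t₂ i) B) :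
    IsRamificationStructure T₁ T₂ where
  left := hS₁
  right := hS₂
  disjoint := conjCyclic_inter (by norm_num) (by norm_num) hT₁ hT₂
    fun i j _ _ hz hz' => (hA i).not_conjMod hΛ (hB j) hAB hz hz'

end Quotient

/-! ### The bound on the level -/

theorem exists_of_firstIndex_le {k : Fin 3} {τ : ℕ → Fin 3} {n : ℕ}
    (h : firstIndex k τ + 4 ≤ n) : ∃ s, τ s = k ∧ s + 5 ≤ n := by
  by_contra! hs
  -- truncated subtraction is harmless: `n - 3 + 4 > n` for all `n`
  have h1 : ((n - 3 : ℕ) : ℕ∞) ≤ firstIndex k τ :=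
    le_iInf₂ fun m hm => Nat.cast_le.2 (by have := hs m hm; omega)
  have h2 : (((n - 3) + 4 : ℕ) : ℕ∞) ≤ n := by
    push_cast
    exact (add_le_add_left h1 4).trans h
  have := Nat.cast_le.1 h2
  omega

theorem firstIndex_add_four_le {ω : ℕ → Fin 3} (hω : ¬ IsConstant (shift ω)) {k : Fin 3}
    (hk : firstIndex k (shift ω) ≠ ⊤) : firstIndex k (shift ω) + 4 ≤ boundM ω := by
  unfold boundM
  split_ifs
  · exact add_le_add_left (le_iSup (fun k => firstIndex k (shift ω)) k) 4
  · exact add_le_add_left (le_iSup₂ (f := fun k (_ : firstIndex k (shift ω) ≠ ⊤) =>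
      firstIndex k (shift ω)) k hk) 4

/-- Since at most one letter is missing from `σω`, one of any two letters occurs early. -/
theorem exists_eq_or_eq {ω : ℕ → Fin 3} (hω : ¬ IsConstant (shift ω)) {n : ℕ}
    (hn : boundM ω ≤ n) {l m : Fin 3} (hlm : l ≠ m) :
    ∃ s, (shift ω s = l ∨ shift ω s = m) ∧ s + 5 ≤ n := by
  have h : ∃ r, shift ω r = l ∨ shift ω r = m := by
    by_contra! h
    have third : ∀ l m x y : Fin 3, l ≠ m → x ≠ l → x ≠ m → y ≠ l → y ≠ m → x = y := by decide
    exact hω ⟨shift ω 0, fun r => third l m _ _ hlm (h r).1 (h r).2 (h 0).1 (h 0).2⟩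
  have key : ∀ {x r}, shift ω r = x → ∃ s, shift ω s = x ∧ s + 5 ≤ n := by
    intro x r hr
    refine exists_of_firstIndex_le ((firstIndex_add_four_le hω ?_).trans hn)
    exact ne_top_of_le_ne_top (ENat.natCast_ne_top (r + 1)) (iInf₂_le r hr)
  obtain ⟨r, hr | hr⟩ := h
  · obtain ⟨s, hs, hsn⟩ := key hr
    exact ⟨s, Or.inl hs, hsn⟩
  · obtain ⟨s, hs, hsn⟩ := key hr
    exact ⟨s, Or.inr hs, hsn⟩

theorem four_le_of_const {ω : ℕ → Fin 3} {i : Fin 3} (hi : ∀ m, shift ω m = i) {n : ℕ}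
    (hn : boundM ω ≤ n) : 4 ≤ n := by
  have h1 : firstIndex (i + 1) (shift ω) = ⊤ := by
    have hne : i ≠ i + 1 := by
      clear hi
      revert i
      decide
    simp [firstIndex, hi, hne]
  have h2 : boundN ω = ⊤ := by
    have : (⨆ k, firstIndex k (shift ω)) = ⊤ :=
      top_le_iff.1 (h1 ▸ le_iSup (fun k => firstIndex k (shift ω)) (i + 1))
    rw [boundN, this, top_add]
  have h3 : IsConstant (shift ω) := ⟨i, hi⟩
  rw [boundM, if_neg (not_not.2 h2), if_neg (not_not.2 h3)] at hn
  exact_mod_cast hn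

/-! ### The two ramification structures -/

section Structures

variable {ω : ℕ → Fin 3} {n : ℕ} {i j k l : Fin 3}

theorem four_notMem (hn : 1 ≤ n) (hi : ω 0 ≠ i) :
    rootedA * directed i ω * rootedA * directed l ω ∉ levelStab (n + 1) := by
  rw [rootedA_mul_directed_mul hi, pair_mem_levelStab]
  exact fun h => rootedA_mul_notMem (directed_mem_levelStab_one l _) (levelStab_anti hn h.2)

theorem rootedA_mul_directed_notMem : rootedA * directed l ω ∉ levelStab (n + 1) :=
  fun h => rootedA_mul_notMem (directed_mem_levelStab_one l ω) (levelStab_anti (by omega) h)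

theorem directed_mul_rootedA_mul_directed_notMem :
    directed i ω * rootedA * directed l ω ∉ levelStab (n + 1) := fun h => by
  have h := levelStab_anti (show 1 ≤ n + 1 by omega) h
  rw [Subgroup.mul_mem_cancel_right _ (directed_mem_levelStab_one l ω),
    Subgroup.mul_mem_cancel_left _ (directed_mem_levelStab_one i ω)] at h
  exact rootedA_notMem_levelStab_one h

theorem directed_notMem_succ (hx : directed l (shift ω) ∉ levelStab n) :
    directed l ω ∉ levelStab (n + 1) := by
  rw [directed_eq, pair_mem_levelStab]
  exact fun h => hx h.2

/-- The word `x_i a x_j` is conjugate to `a x_k`. -/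
theorem isConj_three (hij : i ≠ j) (hik : i ≠ k) (hjk : j ≠ k) :
    IsConj (directed i ω * rootedA * directed j ω) (rootedA * directed k ω) := by
  rw [mul_assoc, ← directed_mul_directed hij.symm hjk hik, ← mul_assoc]
  exact isConj_mul_swap (directed i ω) (rootedA * directed j ω)

/-- On the level below, all of `1`, `a`, `x_l'` and the involutions attached to the `a x_l'` are
told apart, and the two tuples produce disjoint sets of unordered pairs of these. -/
theorem isRamificationStructure_tupleT (π : Equiv.Perm (Fin 3))
    (hΛ : Separates Set.univ n (shift ω)) (hx : ∀ l, directed l (shift ω) ∉ levelStab n)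
    (h0 : ω 0 ≠ π 0) :
    IsRamificationStructure
      (tupleT₁ (quotA ω (n + 1)) (quotDirected (π 2) ω (n + 1)) (quotDirected (π 1) ω (n + 1))
        (quotDirected (π 0) ω (n + 1)))
      (tupleT₂ (quotA ω (n + 1)) (quotDirected (π 1) ω (n + 1))
        (quotDirected (π 0) ω (n + 1))) := by
  have h01 : π 0 ≠ π 1 := π.injective.ne (by decide)
  have h02 : π 0 ≠ π 2 := π.injective.ne (by decide)
  have h12 : π 1 ≠ π 2 := π.injective.ne (by decide)
  have hn := hΛ.one_le
  have hT₁ : ∀ m, toFull ω (n + 1) (tupleT₁ (quotA ω (n + 1)) (quotDirected (π 2) ω (n + 1))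
      (quotDirected (π 1) ω (n + 1)) (quotDirected (π 0) ω (n + 1)) m) =
      (tupleT₁ rootedA (directed (π 2) ω) (directed (π 1) ω) (directed (π 0) ω) m : treeAut) := by
    intro m
    fin_cases m <;> rfl
  have hT₂ : ∀ m, toFull ω (n + 1) (tupleT₂ (quotA ω (n + 1))
      (quotDirected (π 1) ω (n + 1)) (quotDirected (π 0) ω (n + 1)) m) =
      (tupleT₂ rootedA (directed (π 1) ω) (directed (π 0) ω) m : treeAut) := by
    intro m
    fin_cases m <;> rfl
  have hS₁ := isSphericalSystem_of_lift hT₁ (by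
      intro m
      fin_cases m
      · exact rootedA_notMem_levelStab (by omega)
      · exact directed_notMem_succ (hx _)
      · exact directed_mul_rootedA_mul_directed_notMem
      · exact fun h => four_notMem hn h0 (inv_mem_iff.1 h))
    (closure_eq_top (tupleT₁_gen (quotDirected_mul h12.symm h02.symm h01.symm)))
    (tupleT₁_prod (quotDirected_mul h12.symm h02.symm h01.symm))
  have hS₂ := isSphericalSystem_of_lift hT₂ (by
      intro m
      fin_cases m
      · exact rootedA_mul_directed_notMem
      · exact directed_notMem_succ (hx _)
      · exact directed_mul_rootedA_mul_directed_notMem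
      · exact fun h => four_notMem hn h0 (inv_mem_iff.1 h))
    (closure_eq_top (tupleT₂_gen (quotDirected_mul h01.symm h12 h02)))
    (tupleT₂_prod (quotDirected_mul_self _))
  have hcase : ω 0 = π 1 ∨ ω 0 = π 2 := by
    obtain ⟨m, hm⟩ := π.surjective (ω 0)
    rw [← hm] at h0 ⊢
    fin_cases m
    · exact absurd rfl h0
    · exact Or.inl rfl
    · exact Or.inr rfl
  have hi := invTypes_rootedA_mul_directed_of_ne hn h0 (Set.mem_univ _) (hx _)
  rcases hcase with h | h
  · have hk : ω 0 ≠ π 2 := by rwa [h]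
    refine isRamificationStructure_of_types hT₁ hT₂ hS₁ hS₂ hΛ
      (A := {none, some s(.root, .dir), some s(.inv (π 0), .inv (π 0)),
        some s(.inv (π 0), .inv (π 2)), some s(.one, .inv (π 2)), some s(.inv (π 0), .one)})
      (B := {some s(.dir, .dir), some s(.one, .dir), some s(.inv (π 2), .inv (π 2)),
        some s(.one, .inv (π 1))}) ?_ ?_ ?_
    · simp [h12, h01.symm, h02.symm]
    · intro m
      fin_cases m
      · exact invTypes_rootedA.mono (by simp)
      · exact (invTypes_directed_of_ne hk (hx _)).mono (by simp)
      · exact (hi.of_isConj (isConj_three h12 h01.symm h02.symm)).mono (by simp)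
      · exact (invTypes_four_of_ne hn h0 hk (Set.mem_univ _) (Set.mem_univ _)
          (hx _) (hx _)).inv.mono (by simp [Set.insert_subset_iff])
    · intro m
      fin_cases m
      · exact (invTypes_rootedA_mul_directed_of_eq h (hx _)).mono (by simp)
      · exact (invTypes_directed_of_eq h (hx _)).mono (by simp)
      · exact ((invTypes_rootedA_mul_directed_of_ne hn hk (Set.mem_univ _) (hx _)).of_isConj
          (isConj_three h01 h02 h12)).mono (by simp)
      · exact (invTypes_four_of_eq h0 h (Set.mem_univ _) (hx _)).inv.mono (by simp)
  · have hj : ω 0 ≠ π 1 := by rw [h]; exact h12.symm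
    refine isRamificationStructure_of_types hT₁ hT₂ hS₁ hS₂ hΛ
      (A := {none, some s(.one, .dir), some s(.inv (π 0), .inv (π 0)), some s(.one, .inv (π 2))})
      (B := {some s(.inv (π 1), .inv (π 1)), some s(.root, .dir), some s(.dir, .dir),
        some s(.inv (π 0), .inv (π 1)), some s(.one, .inv (π 1)), some s(.inv (π 0), .one)})
      ?_ ?_ ?_
    · simp [h02, h12, h01.symm]
    · intro m
      fin_cases m
      · exact invTypes_rootedA.mono (by simp)
      · exact (invTypes_directed_of_eq h (hx _)).mono (by simp)
      · exact (hi.of_isConj (isConj_three h12 h01.symm h02.symm)).mono (by simp)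
      · exact (invTypes_four_of_eq h0 h (Set.mem_univ _) (hx _)).inv.mono (by simp)
    · intro m
      fin_cases m
      · exact (invTypes_rootedA_mul_directed_of_ne hn hj (Set.mem_univ _) (hx _)).mono (by simp)
      · exact (invTypes_directed_of_ne hj (hx _)).mono (by simp)
      · exact ((invTypes_rootedA_mul_directed_of_eq h (hx _)).of_isConj
          (isConj_three h01 h02 h12)).mono (by simp)
      · exact (invTypes_four_of_ne hn h0 hj (Set.mem_univ _) (Set.mem_univ _)
          (hx _) (hx _)).inv.mono (by simp [Set.insert_subset_iff])

/-- The case of a constant tail: then `x_{π 0} = (a, 1)`, and the directed generators for the two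
other letters have the same section at the vertex `1`. -/
theorem isRamificationStructure_tupleS (π : Equiv.Perm (Fin 3)) (hn : 2 ≤ n)
    (h2 : ω 0 = π 2) (hconst : ∀ m, shift ω m = π 0) :
    IsRamificationStructure
      (tupleS₁ (quotA ω (n + 1)) (quotDirected (π 2) ω (n + 1)) (quotDirected (π 1) ω (n + 1))
        (quotDirected (π 0) ω (n + 1)))
      (tupleS₂ (quotA ω (n + 1)) (quotDirected (π 2) ω (n + 1)) (quotDirected (π 1) ω (n + 1))
        (quotDirected (π 0) ω (n + 1))) := by
  have h01 : π 0 ≠ π 1 := π.injective.ne (by decide)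
  have h02 : π 0 ≠ π 2 := π.injective.ne (by decide)
  have h12 : π 1 ≠ π 2 := π.injective.ne (by decide)
  have h0 : ω 0 ≠ π 0 := by rw [h2]; exact h02.symm
  have h1 : ω 0 ≠ π 1 := by rw [h2]; exact h12.symm
  have hn1 : 1 ≤ n := by omega
  -- here `x_{π 1}' = x_{π 2}'`, so that only the label of the letter `π 2` may be used
  have hΛ : Separates {π 2} n (shift ω) :=
    ⟨hn1, by rintro l rfl m rfl h; exact absurd rfl h⟩
  have hx1 : directed (π 1) (shift ω) ∉ levelStab n :=
    directed_notMem_levelStab (s := 0) (by rwa [hconst]) hn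
  have hx2 : directed (π 2) (shift ω) ∉ levelStab n :=
    directed_notMem_levelStab (s := 0) (by rwa [hconst]) hn
  have hd := directed_eq_pair_of_const h0 hconst
  have hd' : directed (π 0) ω ∉ levelStab (n + 1) := by
    rw [hd, pair_mem_levelStab]
    exact fun h => rootedA_notMem_levelStab hn1 h.1
  have hx12 : directed (π 1) (shift ω) = directed (π 2) (shift ω) := by
    rw [← directed_mul_directed h01 h02 h12, directed_eq_one hconst, one_mul]
  have hT₁ : ∀ m, toFull ω (n + 1) (tupleS₁ (quotA ω (n + 1)) (quotDirected (π 2) ω (n + 1))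
      (quotDirected (π 1) ω (n + 1)) (quotDirected (π 0) ω (n + 1)) m) =
      (tupleS₁ rootedA (directed (π 2) ω) (directed (π 1) ω) (directed (π 0) ω) m : treeAut) := by
    intro m
    fin_cases m <;> rfl
  have hT₂ : ∀ m, toFull ω (n + 1) (tupleS₂ (quotA ω (n + 1)) (quotDirected (π 2) ω (n + 1))
      (quotDirected (π 1) ω (n + 1)) (quotDirected (π 0) ω (n + 1)) m) =
      (tupleS₂ rootedA (directed (π 2) ω) (directed (π 1) ω) (directed (π 0) ω) m : treeAut) := by
    intro m
    fin_cases m <;> rfl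
  have hS₁ := isSphericalSystem_of_lift hT₁ (by
      intro m
      fin_cases m
      · exact rootedA_notMem_levelStab (by omega)
      · exact directed_notMem_succ hx2
      · exact directed_notMem_succ hx1
      · exact fun h => rootedA_mul_directed_notMem (inv_mem_iff.1 h))
    (closure_eq_top (tupleS₁_gen (quotDirected_mul h12.symm h02.symm h01.symm)))
    (tupleS₁_prod (quotDirected_mul h12.symm h02.symm h01.symm))
  have hS₂ := isSphericalSystem_of_lift hT₂ (by
      intro m
      fin_cases m
      · exact rootedA_mul_directed_notMem
      · exact hd'
      · intro h
        change rootedA * directed (π 2) ω * rootedA * directed (π 0) ω ∈ _ at h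
        rw [mul_assoc (_ * _), (levelStab_normal (n + 1)).mem_comm_iff, ← mul_assoc] at h
        exact four_notMem hn1 h0 h
      · intro h
        have h := levelStab_anti (show 1 ≤ n + 1 by omega) (inv_mem_iff.1 h)
        rw [rootedA_mul_directed_mul h1,
          Subgroup.mul_mem_cancel_right _ (directed_mem_levelStab_one _ ω),
          Subgroup.mul_mem_cancel_left _ (pair_mem_levelStab_one _ _)] at h
        exact rootedA_notMem_levelStab_one h)
    (closure_eq_top (tupleS₂_gen (quotDirected_mul h02.symm h12.symm h01)))
    (tupleS₂_prod (quotDirected_mul h02.symm h12.symm h01))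
  refine isRamificationStructure_of_types hT₁ hT₂ hS₁ hS₂ hΛ
    (A := {none, some s(.one, .dir), some s(.root, .dir), some s(.root, .root)})
    (B := {some s(.dir, .dir), some s(.root, .one), some s(.one, .inv (π 2)),
      some s(.inv (π 2), .inv (π 2))}) ?_ ?_ ?_
  · simp
  · rw [hd]
    intro m
    fin_cases m
    · exact invTypes_rootedA.mono (by simp)
    · exact (invTypes_directed_of_eq h2 hx2).mono (by simp)
    · exact (invTypes_directed_of_ne h1 hx1).mono (by simp)
    · exact (invTypes_const_rootedA_mul hn1).inv.mono (by simp)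
  · rw [hd]
    intro m
    fin_cases m
    · exact (invTypes_rootedA_mul_directed_of_eq h2 hx2).mono (by simp)
    · exact invTypes_const_directed.mono (by simp)
    · exact (invTypes_const_four h2 (Set.mem_singleton _) hx2).mono (by simp)
    · exact (invTypes_const_six hn1 h2 h1 hx12 (Set.mem_singleton _) hx2).inv.mono (by simp)

end Structures

end Grigorchuk

theorem theorem1 (ω : ℕ → Fin 3) (hω : ¬ Grigorchuk.IsConstant ω)
    (n : ℕ) (hn : Grigorchuk.boundM ω ≤ n) :
    IsPGroup 2 (Grigorchuk.levelQuotient ω n) ∧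
    Grigorchuk.AdmitsRamificationStructure (Grigorchuk.levelQuotient ω n) 4 4 ∧
    (¬ Grigorchuk.IsConstant (Grigorchuk.shift ω) →
      ∀ π : Equiv.Perm (Fin 3), ω 0 ≠ π 0 →
        Grigorchuk.IsRamificationStructure
          (Grigorchuk.tupleT₁ (Grigorchuk.quotA ω n) (Grigorchuk.quotDirected (π 2) ω n)
            (Grigorchuk.quotDirected (π 1) ω n) (Grigorchuk.quotDirected (π 0) ω n))
          (Grigorchuk.tupleT₂ (Grigorchuk.quotA ω n)
            (Grigorchuk.quotDirected (π 1) ω n) (Grigorchuk.quotDirected (π 0) ω n))) ∧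
    (∀ π : Equiv.Perm (Fin 3), ω 0 = π 2 → (∀ m, Grigorchuk.shift ω m = π 0) →
        Grigorchuk.IsRamificationStructure
          (Grigorchuk.tupleS₁ (Grigorchuk.quotA ω n) (Grigorchuk.quotDirected (π 2) ω n)
            (Grigorchuk.quotDirected (π 1) ω n) (Grigorchuk.quotDirected (π 0) ω n))
          (Grigorchuk.tupleS₂ (Grigorchuk.quotA ω n) (Grigorchuk.quotDirected (π 2) ω n)
            (Grigorchuk.quotDirected (π 1) ω n) (Grigorchuk.quotDirected (π 0) ω n))) := by
  open Grigorchuk in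
  have hT : ¬ IsConstant (shift ω) → ∀ π : Equiv.Perm (Fin 3), ω 0 ≠ π 0 →
      IsRamificationStructure
        (tupleT₁ (quotA ω n) (quotDirected (π 2) ω n) (quotDirected (π 1) ω n)
          (quotDirected (π 0) ω n))
        (tupleT₂ (quotA ω n) (quotDirected (π 1) ω n) (quotDirected (π 0) ω n)) := by
    intro hσ π h0
    obtain ⟨s, -, hs⟩ := exists_eq_or_eq hσ hn (show (0 : Fin 3) ≠ 1 by decide)
    obtain ⟨n, rfl⟩ := Nat.exists_eq_add_of_le' (show 1 ≤ n by omega)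
    refine isRamificationStructure_tupleT π ⟨by omega, fun l _ m _ hlm => ?_⟩ (fun l => ?_) h0
    · obtain ⟨s, hs, hsn⟩ := exists_eq_or_eq hσ hn hlm
      exact ⟨s, hs, by omega⟩
    · have hl : l + 1 ≠ l + 2 ∧ l + 1 ≠ l ∧ l + 2 ≠ l := by
        revert l
        decide
      obtain ⟨s, hs, hsn⟩ := exists_eq_or_eq hσ hn hl.1
      refine directed_notMem_levelStab (s := s) ?_ (by omega)
      rcases hs with hs | hs
      · rw [hs]; exact hl.2.1
      · rw [hs]; exact hl.2.2
  open Grigorchuk in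
  have hS : ∀ π : Equiv.Perm (Fin 3), ω 0 = π 2 → (∀ m, shift ω m = π 0) →
      IsRamificationStructure
        (tupleS₁ (quotA ω n) (quotDirected (π 2) ω n) (quotDirected (π 1) ω n)
          (quotDirected (π 0) ω n))
        (tupleS₂ (quotA ω n) (quotDirected (π 2) ω n) (quotDirected (π 1) ω n)
          (quotDirected (π 0) ω n)) := by
    intro π h2 hconst
    have h4 := four_le_of_const hconst hn
    obtain ⟨n, rfl⟩ := Nat.exists_eq_add_of_le' (show 1 ≤ n by omega)
    exact isRamificationStructure_tupleS π (by omega) h2 hconst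
  refine ⟨Grigorchuk.levelQuotient_isPGroup ω n,
    ⟨Grigorchuk.levelQuotient_finite ω n, ?_⟩, hT, hS⟩
  by_cases hσ : Grigorchuk.IsConstant (Grigorchuk.shift ω)
  · obtain ⟨i, hi⟩ := hσ
    have h0 : ω 0 ≠ i := fun h => hω ⟨i, fun m => by
      cases m with
      | zero => exact h
      | succ m => exact hi m⟩
    have hπ : ∀ x y : Fin 3, x ≠ y → ∃ π : Equiv.Perm (Fin 3), x = π 2 ∧ y = π 0 := by decide
    obtain ⟨π, hπ2, rfl⟩ := hπ _ _ h0
    exact ⟨_, _, hS π hπ2 hi⟩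
  · refine ⟨_, _, hT hσ (Equiv.swap 0 (ω 0 + 1)) ?_⟩
    rw [Equiv.swap_apply_left]
    generalize ω 0 = w
    revert w
    decide
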